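/- **Theorem.** Let $n\in\mathbb N$, write $z=(x,y)=(x_1,\dots,x_n,y_1,\dots,y_n)$ for the canonical coordinates of $\mathbb R^{2n}$, and let $\omega\in\mathbb R^n$ be non-resonant, i.e. $e^{i\langle k,\omega\rangle\pm i\omega_j}\neq1$ for all $k\in\mathbb Z^n$ with $|k|=|k_1|+\dots+|k_n|>1$, all $j=1,\dots,n$ and both signs. Let $$\Lambda_\omega=\begin{pmatrix}C_\omega&-S_\omega\\ S_\omega&C_\omega\end{pmatrix},\qquad C_\omega=\mathrm{diag}(\cos\omega_1,\dots,\cos\omega_n),\quad S_\omega=\mathrm{diag}(\sin\omega_1,\dots,\sin\omega_n).$$ A formal map of $\mathbb R^{2n}$ is a $2n$-tuple of real formal power series in $z$; it is symplectic if its Jacobian matrix is a symplectic matrix, identically in $z$. Let $$z'=F(z)=\Lambda_\omega z+F_2(z)$$ be a symplectic formal map, where $F_2$ is a formal power series starting with terms of degree at least $2$. Let $I_j=\frac{x_j^2+y_j^2}{2}$ $(j=1,\dots,n)$ be the actions. Then for every $r\ge1$ there exists a formal near-the-identity symplectic transformation $w=\Phi(z)=z+O(|z|^2)$ which conjugates the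 map $w'=F(w)$ to the normal form $$z'=\Omega^{(r)}z+P^{(r+1)}(z),\qquad\text{i.e.}\quad F(\Phi(z))=\Phi\bigl(\Omega^{(r)}z+P^{(r+1)}(z)\bigr),$$ where $\Omega^{(r)}=\Lambda_\omega+\tilde\Omega^{(r)}(I_1,\dots,I_n)$ is a symplectic matrix, the entries of $\tilde\Omega^{(r)}$ are formal power series in the actions without constant term (i.e. $\tilde\Omega^{(r)}$ is at least linear in the actions), and $P^{(r+1)}$ is a formal power series starting with terms of degree at least $r+2$. Finally, the truncated map $z'=\Omega^{(r)}(I_1,\dots,I_n)\,z$ is integrable: it is symplectic, and the actions $I_1,\dots,I_n$ are $n$ functionally independent first integrals of it in involution. -/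

import Mathlib

noncomputable section

namespace SymplecticNormalForm

/-- Indices of the canonical coordinates `z = (x, y) ∈ ℝ^{2n}`:
`Sum.inl j` is `x_j` and `Sum.inr j` is `y_j`. -/
abbrev Coord (n : ℕ) : Type := Fin n ⊕ Fin n

/-- Real formal power series in the `2n` coordinates `z = (x, y)`. -/
abbrev Series (n : ℕ) : Type := MvPowerSeries (Coord n) ℝ

/-- A formal map `z' = T(z)` of `ℝ^{2n}`, given by its `2n` components.
All the maps considered have components without constant term. -/
abbrev FormalMap (n : ℕ) : Type := Coord n → Series n

variable {n : ℕ}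

/-- The composition `z ↦ S(T(z))` of formal maps; it is meaningful (no junk value) when
the components of `T` have no constant term. -/
def comp (S T : FormalMap n) : FormalMap n :=
  fun a => MvPowerSeries.subst T (S a)

/-- The pullback `f ∘ T` of a formal power series by a formal map. -/
def pullback (T : FormalMap n) (f : Series n) : Series n :=
  MvPowerSeries.subst T f

/-- The Jacobian matrix `∂T_a/∂z_b`. -/
def jacobian (T : FormalMap n) : Matrix (Coord n) (Coord n) (Series n) :=
  Matrix.of fun a b => MvPowerSeries.pderiv ℝ b (T a)

/-- A formal map is symplectic when its Jacobian matrix is a symplectic matrix, identically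
in `z`. -/
def IsSymplecticMap (T : FormalMap n) : Prop :=
  jacobian T ∈ Matrix.symplecticGroup (Fin n) (Series n)

/-- Each component of the formal map consists of terms of degree at least `d`. -/
def StartsAtDegree (d : ℕ) (T : FormalMap n) : Prop :=
  ∀ a, (d : ℕ∞) ≤ (T a).order

/-- Near the identity: `T(z) = z + (terms of degree at least 2)`. -/
def IsNearIdentity (T : FormalMap n) : Prop :=
  ∃ φ : FormalMap n, StartsAtDegree 2 φ ∧ ∀ a, T a = MvPowerSeries.X a + φ a

/-- The block rotation matrix `Λ_ω = (C_ω, -S_ω; S_ω, C_ω)`, with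
`C_ω = diag(cos ω_j)` and `S_ω = diag(sin ω_j)`. -/
def rotationMatrix (ω : Fin n → ℝ) : Matrix (Coord n) (Coord n) ℝ :=
  Matrix.fromBlocks
    (Matrix.diagonal fun j => Real.cos (ω j)) (-Matrix.diagonal fun j => Real.sin (ω j))
    (Matrix.diagonal fun j => Real.sin (ω j)) (Matrix.diagonal fun j => Real.cos (ω j))

/-- The linear map `z ↦ A z` with constant coefficients, as a formal map. -/
def linearMap (A : Matrix (Coord n) (Coord n) ℝ) : FormalMap n :=
  fun a => ∑ b, MvPowerSeries.C (A a b) * MvPowerSeries.X b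

/-- Non-resonance: `e^{i⟨k,ω⟩ ± iω_j} ≠ 1` for all `k ∈ ℤⁿ` with
`|k| = |k_1| + … + |k_n| > 1` and all `j`. -/
def NonResonant (ω : Fin n → ℝ) : Prop :=
  ∀ k : Fin n → ℤ, 1 < ∑ l, |k l| → ∀ j : Fin n,
    Complex.exp (Complex.I * (((∑ l, (k l : ℝ) * ω l) + ω j : ℝ) : ℂ)) ≠ 1 ∧
    Complex.exp (Complex.I * (((∑ l, (k l : ℝ) * ω l) - ω j : ℝ) : ℂ)) ≠ 1

/-- The action `I_j = (x_j² + y_j²) / 2`. -/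
def actionVar (j : Fin n) : Series n :=
  MvPowerSeries.C (1 / 2 : ℝ) *
    (MvPowerSeries.X (Sum.inl j) ^ 2 + MvPowerSeries.X (Sum.inr j) ^ 2)

/-- Real formal power series in `n` variables, which stand for the actions. -/
abbrev ActionSeries (n : ℕ) : Type := MvPowerSeries (Fin n) ℝ

/-- The formal map `z ↦ Ω(I_1(z), …, I_n(z)) z`, for a matrix `Ω` whose entries are formal
power series in the actions. -/
def actionMap (Ω : Matrix (Coord n) (Coord n) (ActionSeries n)) : FormalMap n :=
  fun a => ∑ b, MvPowerSeries.subst (actionVar (n := n)) (Ω a b) * MvPowerSeries.X b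

/-- The canonical Poisson bracket `{f, g} = ∑_j (∂f/∂x_j ∂g/∂y_j - ∂f/∂y_j ∂g/∂x_j)`. -/
def poissonBracket (f g : Series n) : Series n :=
  ∑ j : Fin n,
    (MvPowerSeries.pderiv ℝ (Sum.inl j) f * MvPowerSeries.pderiv ℝ (Sum.inr j) g -
      MvPowerSeries.pderiv ℝ (Sum.inr j) f * MvPowerSeries.pderiv ℝ (Sum.inl j) g)

/-- The gradient of a formal power series. -/
def seriesGradient (f : Series n) : Coord n → Series n :=
  fun a => MvPowerSeries.pderiv ℝ a f

/-- The formal map `T` of `ℝ^{2n}` is (Liouville) integrable with first integrals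
`K_1, …, K_n`: it is symplectic, and the `K_j` are invariant under `T`, pairwise in
involution and functionally independent. -/
structure IsIntegrableWith (T : FormalMap n) (K : Fin n → Series n) : Prop where
  symplectic : IsSymplecticMap T
  invariant : ∀ j, pullback T (K j) = K j
  involution : ∀ i j, poissonBracket (K i) (K j) = 0
  independent : LinearIndependent (Series n) fun j => seriesGradient (K j)

end SymplecticNormalForm

end

open SymplecticNormalForm

/-!
The theorem is the Birkhoff normal form of a symplectic map at a non-resonant elliptic fixed point.
The map is normalized degree by degree. Suppose that it has been conjugated to `G = R + P`, where
`R(z) = Ω(I) z` rotates each pair `(x_j, y_j)` by an angle `ω_j + ∂h/∂I_j`, and `P` starts at degree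
`d ≥ 2`. As `G` and `R` are both symplectic, the leading part of `Λ⁻¹ P` is a Hamiltonian vector
field `J ∇K'` (`exists_hamField_of_isSymplecticMap`; Euler's identity gives the potential `K'`).
A symplectic map `S = z + J ∇K + …` and a correction `h + k` of `h` remove this leading part as soon
as the homological equation `K' = K ∘ Λ - K + k(I)` holds to leading order
(`exists_conj_normalForm_succ`).

The homological equation is solved on the monomials in `ζ_j = x_j + i y_j` and their conjugates, on
which the rotation acts by the phases `e^{i⟨m,ω⟩}`, where `m` is the difference of the exponents.
Non-resonance says that the phase is different from `1` for `m ≠ 0`, and for `m = 0` the monomial is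
a product of actions (`isHomologicallySolvable_monomial`).

Two devices keep all the maps explicit. First, the map `S` is not the flow of `K` but a composition
of polynomial shears `z + c ⟨v, z⟩^p Jv`, which are symplectic and invertible. This suffices because
the powers of linear forms span the homogeneous polynomials, and because composition adds the
generating Hamiltonians to leading order (`generates_of_mem`). Secondly, the rotations are recorded
through their cosines `c_j` and sines `s_j`, power series in the actions whose angles have a
symmetric matrix of partial derivatives (`IsAngleData`). This symmetry makes the rotation
symplectic, and it is preserved by the multiplication of the numbers `c_j + i s_j`.

Equalities up to terms of degree at least `m` are congruences modulo `orderIdeal`.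
-/

noncomputable section

namespace SymplecticNormalForm

/-! ### Power series modulo terms of high degree -/

section OrderIdeal

variable {σ τ : Type*} {R : Type*} [CommRing R]

/-- The ideal of the power series that consist of terms of degree at least `m`. -/
def orderIdeal (σ R : Type*) [CommRing R] (m : ℕ) : Ideal (MvPowerSeries σ R) where
  carrier := {f | (m : ℕ∞) ≤ f.order}
  zero_mem' := by simp
  add_mem' {f g} hf hg := (le_min hf hg).trans MvPowerSeries.min_order_le_add
  smul_mem' c f hf := by
    rw [smul_eq_mul]
    exact (le_add_of_nonneg_of_le zero_le hf).trans MvPowerSeries.le_order_mul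

theorem mem_orderIdeal {m : ℕ} {f : MvPowerSeries σ R} :
    f ∈ orderIdeal σ R m ↔ (m : ℕ∞) ≤ f.order := Iff.rfl

theorem mem_orderIdeal_iff_coeff {m : ℕ} {f : MvPowerSeries σ R} :
    f ∈ orderIdeal σ R m ↔ ∀ d : σ →₀ ℕ, d.degree < m → MvPowerSeries.coeff d f = 0 := by
  refine ⟨fun h d hd => MvPowerSeries.coeff_of_lt_order (lt_of_lt_of_le ?_ h),
    fun h => MvPowerSeries.nat_le_order h⟩
  exact_mod_cast hd

theorem orderIdeal_anti {m k : ℕ} (h : m ≤ k) : orderIdeal σ R k ≤ orderIdeal σ R m :=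
  fun _ hf => le_trans (by exact_mod_cast h) (mem_orderIdeal.1 hf)

theorem mem_orderIdeal_zero (f : MvPowerSeries σ R) : f ∈ orderIdeal σ R 0 := by
  simp [mem_orderIdeal]

theorem mul_mem_orderIdeal {p q : ℕ} {f g : MvPowerSeries σ R} (hf : f ∈ orderIdeal σ R p)
    (hg : g ∈ orderIdeal σ R q) : f * g ∈ orderIdeal σ R (p + q) := by
  rw [mem_orderIdeal] at *
  push_cast
  exact (add_le_add hf hg).trans MvPowerSeries.le_order_mul

theorem pow_mem_orderIdeal {q : ℕ} {f : MvPowerSeries σ R} (hf : f ∈ orderIdeal σ R q) (p : ℕ) :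
    f ^ p ∈ orderIdeal σ R (q * p) := by
  induction p with
  | zero => simpa using mem_orderIdeal_zero _
  | succ p ih => exact pow_succ f p ▸ mul_mem_orderIdeal ih hf

theorem mem_orderIdeal_one {f : MvPowerSeries σ R} :
    f ∈ orderIdeal σ R 1 ↔ MvPowerSeries.constantCoeff f = 0 := by
  rw [mem_orderIdeal, Nat.cast_one, MvPowerSeries.one_le_order_iff_constCoeff_eq_zero]

theorem X_mem_orderIdeal (a : σ) : (MvPowerSeries.X a : MvPowerSeries σ R) ∈ orderIdeal σ R 1 := by
  simp [mem_orderIdeal_one]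

theorem sub_C_mem_orderIdeal (f : MvPowerSeries σ R) :
    f - MvPowerSeries.C (MvPowerSeries.constantCoeff f) ∈ orderIdeal σ R 1 := by
  simp [mem_orderIdeal_one]

theorem eq_zero_of_forall_mem_orderIdeal {f : MvPowerSeries σ R}
    (h : ∀ m, f ∈ orderIdeal σ R m) : f = 0 := by
  ext d
  simpa using mem_orderIdeal_iff_coeff.1 (h (d.degree + 1)) d (Nat.lt_succ_self _)

/-- Each monomial of positive degree is divisible by one of its variables; the `g a` collect the
quotients. Most statements about orders below follow from this by induction. -/
theorem exists_eq_sum_X_mul [Fintype σ] {m : ℕ} {f : MvPowerSeries σ R}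
    (hf : f ∈ orderIdeal σ R (m + 1)) :
    ∃ g : σ → MvPowerSeries σ R, (∀ a, g a ∈ orderIdeal σ R m) ∧
      f = ∑ a, MvPowerSeries.X a * g a := by
  classical
  have hne : ∀ d : σ →₀ ℕ, d ≠ 0 → ∃ a, d a ≠ 0 := fun d hd => by
    by_contra! h; exact hd (Finsupp.ext h)
  obtain h | h := isEmpty_or_nonempty σ
  · refine ⟨fun _ => 0, fun a => zero_mem _, ?_⟩
    ext d
    rw [mem_orderIdeal_iff_coeff.1 hf d (by simp [Subsingleton.elim d 0])]
    simp
  -- `v d` is a variable that occurs in the monomial of exponent `d`.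
  choose! v hv using hne
  obtain ⟨g, hg⟩ : ∃ g : σ → MvPowerSeries σ R, ∀ a e, MvPowerSeries.coeff e (g a) =
      if v (e + Finsupp.single a 1) = a then
        MvPowerSeries.coeff (e + Finsupp.single a 1) f else 0 :=
    ⟨fun a => (fun e => if v (e + Finsupp.single a 1) = a then
      MvPowerSeries.coeff (e + Finsupp.single a 1) f else 0 : (σ →₀ ℕ) → R), fun _ _ => rfl⟩
  refine ⟨g, fun a => ?_, ?_⟩
  · rw [mem_orderIdeal_iff_coeff] at hf ⊢
    intro d hd
    rw [hg]
    split_ifs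
    · apply hf
      simp only [map_add, Finsupp.degree_single]
      omega
    · rfl
  · ext d
    rw [map_sum]
    by_cases hd : d = 0
    · subst hd
      rw [mem_orderIdeal_iff_coeff.1 hf 0 (by simp)]
      symm
      exact Finset.sum_eq_zero fun a _ => by simp
    · have key : ∀ a, MvPowerSeries.coeff d (MvPowerSeries.X a * g a) =
          if v d = a then MvPowerSeries.coeff d f else 0 := by
        intro a
        by_cases ha : Finsupp.single a 1 ≤ d
        · obtain ⟨e, rfl⟩ := exists_add_of_le ha
          rw [MvPowerSeries.X_def, MvPowerSeries.coeff_add_monomial_mul, one_mul, add_comm, hg]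
        · rw [MvPowerSeries.X_def, MvPowerSeries.coeff_monomial_mul, if_neg ha, if_neg]
          rintro rfl
          apply ha
          rw [Finsupp.single_le_iff]
          exact Nat.one_le_iff_ne_zero.2 (hv d hd)
      simp only [key]
      simp

theorem exists_eq_C_add_sum_X_mul [Fintype σ] (f : MvPowerSeries σ R) :
    ∃ g : σ → MvPowerSeries σ R,
      f = MvPowerSeries.C (MvPowerSeries.constantCoeff f) + ∑ a, MvPowerSeries.X a * g a := by
  obtain ⟨g, -, hg⟩ := exists_eq_sum_X_mul (m := 0) (sub_C_mem_orderIdeal f)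
  exact ⟨g, by rw [← hg]; ring⟩

theorem hasSubst_of_mem_orderIdeal [Finite σ] {T : σ → MvPowerSeries τ R}
    (hT : ∀ a, T a ∈ orderIdeal τ R 1) : MvPowerSeries.HasSubst T :=
  MvPowerSeries.hasSubst_of_constantCoeff_zero fun a => mem_orderIdeal_one.1 (hT a)

theorem subst_sum_X_mul [Fintype σ] {T : σ → MvPowerSeries τ R} (hT : MvPowerSeries.HasSubst T)
    (g : σ → MvPowerSeries σ R) :
    MvPowerSeries.subst T (∑ a, MvPowerSeries.X a * g a) =
      ∑ a, T a * MvPowerSeries.subst T (g a) := by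
  simp only [← MvPowerSeries.substAlgHom_apply (R := R) hT, map_sum, map_mul,
    MvPowerSeries.substAlgHom_X]

theorem subst_mem_orderIdeal [Fintype σ] {T : σ → MvPowerSeries τ R} {p q : ℕ}
    (hT1 : ∀ a, T a ∈ orderIdeal τ R 1) (hT : ∀ a, T a ∈ orderIdeal τ R q)
    {U : MvPowerSeries σ R} (hU : U ∈ orderIdeal σ R p) :
    MvPowerSeries.subst T U ∈ orderIdeal τ R (q * p) := by
  induction p generalizing U with
  | zero => simpa using mem_orderIdeal_zero _
  | succ p ih =>
    obtain ⟨g, hg, rfl⟩ := exists_eq_sum_X_mul hU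
    rw [subst_sum_X_mul (hasSubst_of_mem_orderIdeal hT1), mul_add_one, add_comm]
    exact sum_mem fun a _ => mul_mem_orderIdeal (hT a) (ih (hg a))

/-- Series that agree up to degree `m` give the same result up to degree `m` when substituted into
a power series. -/
theorem subst_sub_subst_mem_orderIdeal [Fintype σ] {A B : σ → MvPowerSeries τ R} {m : ℕ}
    (hA : ∀ a, A a ∈ orderIdeal τ R 1) (hB : ∀ a, B a ∈ orderIdeal τ R 1)
    (hAB : ∀ a, A a - B a ∈ orderIdeal τ R m) (U : MvPowerSeries σ R) :
    MvPowerSeries.subst A U - MvPowerSeries.subst B U ∈ orderIdeal τ R m := by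
  have hA' := hasSubst_of_mem_orderIdeal hA
  have hB' := hasSubst_of_mem_orderIdeal hB
  -- The precision `q` of the agreement improves by one with each variable split off `U`.
  suffices h : ∀ q (U : MvPowerSeries σ R), MvPowerSeries.subst A U - MvPowerSeries.subst B U ∈
      orderIdeal τ R (min q m) from orderIdeal_anti (by simp) (h m U)
  intro q
  induction q with
  | zero => exact fun U => by simpa using mem_orderIdeal_zero _
  | succ q ih =>
    intro U
    obtain ⟨g, hg⟩ := exists_eq_C_add_sum_X_mul U
    rw [hg, MvPowerSeries.subst_add hA', MvPowerSeries.subst_add hB', subst_sum_X_mul hA',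
      subst_sum_X_mul hB', MvPowerSeries.subst_C, MvPowerSeries.subst_C, add_sub_add_left_eq_sub,
      ← Finset.sum_sub_distrib]
    refine sum_mem fun a _ => ?_
    have : A a * MvPowerSeries.subst A (g a) - B a * MvPowerSeries.subst B (g a) =
        MvPowerSeries.subst A (g a) * (A a - B a) +
          B a * (MvPowerSeries.subst A (g a) - MvPowerSeries.subst B (g a)) := by ring
    rw [this]
    refine add_mem (Ideal.mul_mem_left _ _ (orderIdeal_anti (by simp) (hAB a))) ?_
    exact orderIdeal_anti (by omega) (mul_mem_orderIdeal (hB a) (ih (g a)))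

/-- The agreement improves by `p` degrees if the outer power series starts at degree `p + 1`, since
the increment is controlled by its derivative. -/
theorem subst_sub_subst_mem_orderIdeal_add [Fintype σ] {A B : σ → MvPowerSeries τ R} {m p : ℕ}
    (hA : ∀ a, A a ∈ orderIdeal τ R 1) (hB : ∀ a, B a ∈ orderIdeal τ R 1)
    (hAB : ∀ a, A a - B a ∈ orderIdeal τ R m) {U : MvPowerSeries σ R}
    (hU : U ∈ orderIdeal σ R (p + 1)) :
    MvPowerSeries.subst A U - MvPowerSeries.subst B U ∈ orderIdeal τ R (p + m) := by
  induction p generalizing U with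
  | zero => simpa using subst_sub_subst_mem_orderIdeal hA hB hAB U
  | succ p ih =>
    obtain ⟨g, hg, rfl⟩ := exists_eq_sum_X_mul hU
    rw [subst_sum_X_mul (hasSubst_of_mem_orderIdeal hA),
      subst_sum_X_mul (hasSubst_of_mem_orderIdeal hB), ← Finset.sum_sub_distrib]
    refine sum_mem fun a _ => ?_
    have : A a * MvPowerSeries.subst A (g a) - B a * MvPowerSeries.subst B (g a) =
        MvPowerSeries.subst A (g a) * (A a - B a) +
          B a * (MvPowerSeries.subst A (g a) - MvPowerSeries.subst B (g a)) := by ring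
    rw [this]
    refine add_mem ?_ (orderIdeal_anti (by omega) (mul_mem_orderIdeal (hB a) (ih (hg a))))
    have := subst_mem_orderIdeal hA hA (hg a)
    rw [one_mul] at this
    exact mul_mem_orderIdeal this (hAB a)

/-- The chain rule. Both sides are derivations of `U` along the substitution and agree on the
variables, so they agree to any order. -/
theorem pderiv_subst [Fintype σ] {T : σ → MvPowerSeries τ R}
    (hT : ∀ a, T a ∈ orderIdeal τ R 1) (b : τ) (U : MvPowerSeries σ R) :
    MvPowerSeries.pderiv R b (MvPowerSeries.subst T U) =
      ∑ a, MvPowerSeries.subst T (MvPowerSeries.pderiv R a U) * MvPowerSeries.pderiv R b (T a) := by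
  classical
  have hT' := hasSubst_of_mem_orderIdeal hT
  let S := MvPowerSeries.substAlgHom (R := R) hT'
  have hS : ∀ U, MvPowerSeries.subst T U = S U := fun U =>
    (MvPowerSeries.substAlgHom_apply hT' U).symm
  have hSX : ∀ a, S (MvPowerSeries.X a) = T a := fun a => MvPowerSeries.substAlgHom_X hT' a
  have hSC : ∀ r, S (MvPowerSeries.C r) = MvPowerSeries.C r := fun r => by
    rw [← hS, MvPowerSeries.subst_C]
  simp only [hS]
  rw [← sub_eq_zero]
  refine eq_zero_of_forall_mem_orderIdeal fun q => ?_
  induction q generalizing U with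
  | zero => exact mem_orderIdeal_zero _
  | succ q ih =>
    obtain ⟨g, hg⟩ := exists_eq_C_add_sum_X_mul U
    have : MvPowerSeries.pderiv R b (S U) -
        ∑ a, S (MvPowerSeries.pderiv R a U) * MvPowerSeries.pderiv R b (T a) =
        ∑ c, T c * (MvPowerSeries.pderiv R b (S (g c)) -
          ∑ a, S (MvPowerSeries.pderiv R a (g c)) * MvPowerSeries.pderiv R b (T a)) := by
      conv_lhs => rw [hg]
      simp only [map_add, map_sum, map_mul, hSX, hSC, MvPowerSeries.pderiv_C, Derivation.leibniz,
        smul_eq_mul, MvPowerSeries.pderiv_X, Pi.single_apply, zero_add, mul_sub,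
        Finset.sum_sub_distrib, Finset.sum_add_distrib, add_mul, Finset.sum_mul, Finset.mul_sum,
        apply_ite S, map_zero, mul_ite, ite_mul, mul_zero, zero_mul, mul_one]
      rw [Finset.sum_comm (f := fun a c => T c * S (MvPowerSeries.pderiv R a (g c)) *
        MvPowerSeries.pderiv R b (T a))]
      simp only [Finset.sum_ite_eq', Finset.mem_univ, if_true, mul_assoc]
      ring
    rw [this]
    refine sum_mem fun c _ => ?_
    rw [add_comm q 1]
    exact mul_mem_orderIdeal (hT c) (ih (g c))

theorem pderiv_mem_orderIdeal {m : ℕ} {f : MvPowerSeries σ R}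
    (hf : f ∈ orderIdeal σ R (m + 1)) (a : σ) : MvPowerSeries.pderiv R a f ∈ orderIdeal σ R m := by
  rw [mem_orderIdeal_iff_coeff] at *
  intro d hd
  rw [MvPowerSeries.coeff_pderiv, hf, zero_mul]
  simp only [map_add, Finsupp.degree_single]
  omega

/-- Euler's identity for the terms of lowest degree. -/
theorem sum_X_mul_pderiv_sub_mem_orderIdeal [Fintype σ] {p : ℕ} {f : MvPowerSeries σ R}
    (hf : f ∈ orderIdeal σ R p) :
    ∑ a, MvPowerSeries.X a * MvPowerSeries.pderiv R a f - (p : MvPowerSeries σ R) * f ∈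
      orderIdeal σ R (p + 1) := by
  classical
  induction p generalizing f with
  | zero =>
    rw [Nat.cast_zero, zero_mul, sub_zero, zero_add]
    exact sum_mem fun a _ => Ideal.mul_mem_right _ _ (X_mem_orderIdeal a)
  | succ p ih =>
    obtain ⟨g, hg, rfl⟩ := exists_eq_sum_X_mul hf
    have : ∑ a, MvPowerSeries.X a * MvPowerSeries.pderiv R a (∑ a, MvPowerSeries.X a * g a) -
        ((p + 1 : ℕ) : MvPowerSeries σ R) * ∑ a, MvPowerSeries.X a * g a =
        ∑ c, MvPowerSeries.X c * (∑ a, MvPowerSeries.X a * MvPowerSeries.pderiv R a (g c) -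
          (p : MvPowerSeries σ R) * g c) := by
      simp only [map_sum, Derivation.leibniz,
        smul_eq_mul, MvPowerSeries.pderiv_X, Pi.single_apply, mul_sub, Finset.sum_sub_distrib,
        Finset.sum_add_distrib, mul_add, Finset.mul_sum,
        mul_ite, mul_zero, mul_one]
      rw [Finset.sum_comm]
      simp only [Finset.sum_ite_eq', Finset.mem_univ, if_true,
        ← Finset.sum_add_distrib, ← Finset.sum_sub_distrib]
      refine Finset.sum_congr rfl fun c _ => ?_
      rw [Finset.sum_congr rfl fun a _ => mul_left_comm _ _ _]
      push_cast
      ring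
    rw [this]
    refine sum_mem fun c _ => ?_
    rw [add_comm (p + 1) 1]
    exact mul_mem_orderIdeal (X_mem_orderIdeal c) (ih (hg c))

/-- If the submodules `S m` contain the monomials of degree `m`, as the hypotheses ensure, a power
series without terms of degree less than `m` has its part of degree `m` in `S m`. -/
theorem exists_mem_sub_mem_orderIdeal [Fintype σ] (S : ℕ → Submodule R (MvPowerSeries σ R))
    (h0 : 1 ∈ S 0) (hS : ∀ m a, ∀ f ∈ S m, MvPowerSeries.X a * f ∈ S (m + 1)) {m : ℕ}
    {f : MvPowerSeries σ R} (hf : f ∈ orderIdeal σ R m) :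
    ∃ g ∈ S m, f - g ∈ orderIdeal σ R (m + 1) := by
  induction m generalizing f with
  | zero =>
    refine ⟨(MvPowerSeries.constantCoeff f) • 1, (S 0).smul_mem _ h0, ?_⟩
    rw [MvPowerSeries.smul_eq_C_mul, mul_one]
    exact sub_C_mem_orderIdeal f
  | succ m ih =>
    obtain ⟨g, hg, rfl⟩ := exists_eq_sum_X_mul hf
    choose k hk hk' using fun a => ih (hg a)
    refine ⟨∑ a, MvPowerSeries.X a * k a, sum_mem fun a _ => hS m a _ (hk a), ?_⟩
    rw [← Finset.sum_sub_distrib]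
    refine sum_mem fun a _ => ?_
    rw [← mul_sub, add_comm (m + 1) 1]
    exact mul_mem_orderIdeal (X_mem_orderIdeal a) (hk' a)

end OrderIdeal

/-! ### Composition of formal maps and symplectic maps -/

variable {n : ℕ}

/-- Two formal maps agree up to terms of degree at least `m`. -/
def CongrMod (m : ℕ) (S T : FormalMap n) : Prop :=
  ∀ a, S a - T a ∈ orderIdeal (Coord n) ℝ m

theorem CongrMod.refl (m : ℕ) (S : FormalMap n) : CongrMod m S S := fun a => by
  simp

theorem CongrMod.symm {m : ℕ} {S T : FormalMap n} (h : CongrMod m S T) : CongrMod m T S :=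
  fun a => by rw [← neg_sub]; exact neg_mem (h a)

theorem CongrMod.trans {m : ℕ} {S T U : FormalMap n} (h : CongrMod m S T) (h' : CongrMod m T U) :
    CongrMod m S U :=
  fun a => by rw [← sub_add_sub_cancel _ (T a)]; exact add_mem (h a) (h' a)

theorem CongrMod.add {m : ℕ} {S T S' T' : FormalMap n} (h : CongrMod m S T)
    (h' : CongrMod m S' T') : CongrMod m (S + S') (T + T') :=
  fun a => by
    rw [Pi.add_apply, Pi.add_apply, add_sub_add_comm]
    exact add_mem (h a) (h' a)

theorem CongrMod.mono {m k : ℕ} {S T : FormalMap n} (h : CongrMod k S T) (hmk : m ≤ k) :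
    CongrMod m S T := fun a => orderIdeal_anti hmk (h a)

/-- The identity formal map. -/
def idMap (n : ℕ) : FormalMap n := MvPowerSeries.X

theorem startsAtDegree_iff {d : ℕ} {T : FormalMap n} :
    StartsAtDegree d T ↔ ∀ a, T a ∈ orderIdeal (Coord n) ℝ d := Iff.rfl

theorem StartsAtDegree.mono {d e : ℕ} {T : FormalMap n} (h : StartsAtDegree d T) (hed : e ≤ d) :
    StartsAtDegree e T := fun a => orderIdeal_anti hed (h a)

theorem StartsAtDegree.add {d : ℕ} {S T : FormalMap n} (hS : StartsAtDegree d S)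
    (hT : StartsAtDegree d T) : StartsAtDegree d (S + T) :=
  fun a => add_mem (startsAtDegree_iff.1 hS a) (startsAtDegree_iff.1 hT a)

theorem StartsAtDegree.hasSubst {T : FormalMap n} (h : StartsAtDegree 1 T) :
    MvPowerSeries.HasSubst T := hasSubst_of_mem_orderIdeal h

theorem startsAtDegree_idMap : StartsAtDegree 1 (idMap n) := fun a => X_mem_orderIdeal a

theorem StartsAtDegree.comp {d : ℕ} {S T : FormalMap n} (hS : StartsAtDegree d S)
    (hT : StartsAtDegree 1 T) : StartsAtDegree d (comp S T) := fun a => by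
  have := subst_mem_orderIdeal hT hT (hS a)
  rwa [one_mul] at this

theorem comp_assoc (S : FormalMap n) {T U : FormalMap n} (hT : StartsAtDegree 1 T)
    (hU : StartsAtDegree 1 U) : comp (comp S T) U = comp S (comp T U) := by
  funext a
  exact MvPowerSeries.subst_comp_subst_apply hT.hasSubst hU.hasSubst (S a)

theorem comp_idMap (S : FormalMap n) : comp S (idMap n) = S := by
  funext a
  exact congrFun MvPowerSeries.subst_self (S a)

theorem idMap_comp {T : FormalMap n} (hT : StartsAtDegree 1 T) : comp (idMap n) T = T := by
  funext a
  exact MvPowerSeries.subst_X hT.hasSubst a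

theorem add_comp (S S' : FormalMap n) {T : FormalMap n} (hT : StartsAtDegree 1 T) :
    comp (S + S') T = comp S T + comp S' T := by
  funext a
  exact MvPowerSeries.subst_add hT.hasSubst _ _

theorem CongrMod.comp_left {m : ℕ} {A B : FormalMap n} (U : FormalMap n)
    (hA : StartsAtDegree 1 A) (hB : StartsAtDegree 1 B) (h : CongrMod m A B) :
    CongrMod m (comp U A) (comp U B) :=
  fun a => subst_sub_subst_mem_orderIdeal hA hB h (U a)

theorem CongrMod.comp_left_add {m p : ℕ} {A B U : FormalMap n} (hU : StartsAtDegree (p + 1) U)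
    (hA : StartsAtDegree 1 A) (hB : StartsAtDegree 1 B) (h : CongrMod m A B) :
    CongrMod (p + m) (comp U A) (comp U B) :=
  fun a => subst_sub_subst_mem_orderIdeal_add hA hB h (hU a)

theorem CongrMod.comp_right {m : ℕ} {S T U : FormalMap n} (h : CongrMod m S T)
    (hU : StartsAtDegree 1 U) : CongrMod m (comp S U) (comp T U) := fun a => by
  have := subst_mem_orderIdeal hU hU (h a)
  rwa [one_mul, MvPowerSeries.subst_sub hU.hasSubst] at this

theorem jacobian_comp (S : FormalMap n) {T : FormalMap n} (hT : StartsAtDegree 1 T) :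
    jacobian (comp S T) =
      (jacobian S).map (MvPowerSeries.substAlgHom (R := ℝ) hT.hasSubst) * jacobian T := by
  ext1 a b
  simp only [jacobian, comp, Matrix.of_apply, Matrix.mul_apply, Matrix.map_apply,
    MvPowerSeries.substAlgHom_apply]
  exact pderiv_subst hT b (S a)

theorem IsSymplecticMap.map_subst {S T : FormalMap n} (hS : IsSymplecticMap S)
    (hT : StartsAtDegree 1 T) :
    (jacobian S).map (MvPowerSeries.substAlgHom (R := ℝ) hT.hasSubst) ∈
      Matrix.symplecticGroup (Fin n) (Series n) :=
  SymplecticGroup.map_mem (hS : jacobian S ∈ Matrix.symplecticGroup (Fin n) (Series n))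
    (MvPowerSeries.substAlgHom (R := ℝ) hT.hasSubst)

theorem IsSymplecticMap.comp {S T : FormalMap n} (hS : IsSymplecticMap S)
    (hT : IsSymplecticMap T) (hT' : StartsAtDegree 1 T) : IsSymplecticMap (comp S T) := by
  rw [IsSymplecticMap, jacobian_comp S hT']
  exact mul_mem (hS.map_subst hT') hT

theorem mem_symplecticGroup_of_mul_mem {l R : Type*} [Fintype l] [DecidableEq l] [CommRing R]
    {A B : Matrix (l ⊕ l) (l ⊕ l) R} (hA : A ∈ Matrix.symplecticGroup l R)
    (hAB : A * B ∈ Matrix.symplecticGroup l R) : B ∈ Matrix.symplecticGroup l R := by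
  have h := ((⟨A, hA⟩ : Matrix.symplecticGroup l R)⁻¹ * ⟨A * B, hAB⟩).2
  rwa [Submonoid.coe_mul, SymplecticGroup.coe_inv', Matrix.nonsing_inv_mul_cancel_left _ _
    (SymplecticGroup.symplectic_det hA)] at h

/-- A map conjugate to a symplectic map by a symplectic map is symplectic: by the chain rule, its
Jacobian matrix is a quotient of symplectic matrices. -/
theorem IsSymplecticMap.of_conj {F Φ G : FormalMap n} (hF : IsSymplecticMap F)
    (hΦ : IsSymplecticMap Φ) (hΦ1 : StartsAtDegree 1 Φ) (hG1 : StartsAtDegree 1 G)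
    (h : SymplecticNormalForm.comp F Φ = SymplecticNormalForm.comp Φ G) : IsSymplecticMap G := by
  have hM := hF.comp hΦ hΦ1
  have hA := hΦ.map_subst hG1
  rw [h, IsSymplecticMap, jacobian_comp Φ hG1] at hM
  exact mem_symplecticGroup_of_mul_mem hA hM

/-- The matrix `1 + J B` is the exponential of the Hamiltonian matrix `J B`, which squares to
zero. -/
theorem one_add_J_mul_mem_symplecticGroup {l R : Type*} [Fintype l] [DecidableEq l] [CommRing R]
    {B : Matrix (l ⊕ l) (l ⊕ l) R} (hB : B.transpose = B) (hBJ : B * Matrix.J l R * B = 0) :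
    1 + Matrix.J l R * B ∈ Matrix.symplecticGroup l R := by
  rw [SymplecticGroup.mem_iff, Matrix.transpose_add, Matrix.transpose_mul, Matrix.transpose_one,
    Matrix.J_transpose, hB]
  have h1 : Matrix.J l R * B * Matrix.J l R * (B * -Matrix.J l R) =
      - (Matrix.J l R * (B * Matrix.J l R * B) * Matrix.J l R) := by noncomm_ring
  have : (1 + Matrix.J l R * B) * Matrix.J l R * (1 + B * -Matrix.J l R) =
      Matrix.J l R + Matrix.J l R * B * Matrix.J l R * (B * -Matrix.J l R) := by
    noncomm_ring
  rw [this, h1, hBJ]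
  simp

/-! ### Hamiltonian vector fields and shears -/

open Matrix in
theorem dotProduct_J_mulVec_self {l R : Type*} [Fintype l] [DecidableEq l] [CommRing R]
    (w : l ⊕ l → R) : w ⬝ᵥ (J l R *ᵥ w) = 0 := by
  rw [J, fromBlocks_mulVec]
  simp [dotProduct, Fintype.sum_sum_type, Matrix.neg_mulVec, mul_comm]

theorem J_mulVec_C (v : Coord n → ℝ) (a : Coord n) :
    (Matrix.J (Fin n) (Series n)).mulVec (fun b => MvPowerSeries.C (v b)) a =
      MvPowerSeries.C ((Matrix.J (Fin n) ℝ).mulVec v a) := by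
  rw [← Matrix.map_J (l := Fin n) (MvPowerSeries.C (σ := Coord n) (R := ℝ))]
  simp [Matrix.mulVec, dotProduct]

/-- The Hamiltonian vector field `J ∇K` of a formal power series. -/
def hamField (K : Series n) : FormalMap n :=
  Matrix.mulVec (Matrix.J (Fin n) (Series n)) (seriesGradient K)

theorem hamField_add (K L : Series n) : hamField (K + L) = hamField K + hamField L := by
  rw [hamField, hamField, hamField, ← Matrix.mulVec_add]
  congr 1
  funext a
  simp [seriesGradient]

theorem hamField_sub (K L : Series n) : hamField (K - L) = hamField K - hamField L := by
  rw [hamField, hamField, hamField, ← Matrix.mulVec_sub]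
  congr 1
  funext a
  simp [seriesGradient]

theorem startsAtDegree_hamField {m : ℕ} {K : Series n}
    (hK : K ∈ orderIdeal (Coord n) ℝ (m + 1)) : StartsAtDegree m (hamField K) := fun a => by
  change ∑ b, Matrix.J (Fin n) (Series n) a b * MvPowerSeries.pderiv ℝ b K ∈
    orderIdeal (Coord n) ℝ m
  exact Ideal.sum_mem _ fun b _ => Ideal.mul_mem_left _ _ (pderiv_mem_orderIdeal hK b)

/-- The linear form with coefficients `v`. -/
def linForm (v : Coord n → ℝ) : Series n := ∑ a, MvPowerSeries.C (v a) * MvPowerSeries.X a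

theorem linForm_mem (v : Coord n → ℝ) : linForm v ∈ orderIdeal (Coord n) ℝ 1 :=
  sum_mem fun a _ => Ideal.mul_mem_left _ _ (X_mem_orderIdeal a)

theorem pderiv_linForm (v : Coord n → ℝ) (b : Coord n) :
    MvPowerSeries.pderiv ℝ b (linForm v) = MvPowerSeries.C (v b) := by
  simp [linForm, Derivation.leibniz, MvPowerSeries.pderiv_X, Pi.single_apply,
    -Fintype.sum_sum_type]

/-- The shear `z ↦ z + c ℓ(z)^p Jv`, with `ℓ(z) = ⟨v, z⟩`. It is the time-one flow of the
Hamiltonian `c ℓ^{p+1}/(p+1)`. -/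
def shear (v : Coord n → ℝ) (c : ℝ) (p : ℕ) : FormalMap n := fun a =>
  MvPowerSeries.X a +
    Matrix.mulVec (Matrix.J (Fin n) (Series n)) (fun b => MvPowerSeries.C (v b)) a *
      (MvPowerSeries.C c * linForm v ^ p)

theorem startsAtDegree_shear (v : Coord n → ℝ) (c : ℝ) {p : ℕ} (hp : 1 ≤ p) :
    StartsAtDegree 1 (shear v c p) := fun a => by
  refine add_mem (s := orderIdeal (Coord n) ℝ 1) (X_mem_orderIdeal a) ?_
  refine Ideal.mul_mem_left _ _ (Ideal.mul_mem_left _ _ ?_)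
  exact Ideal.pow_mem_of_mem _ (linForm_mem v) p hp

theorem isSymplecticMap_shear (v : Coord n → ℝ) (c : ℝ) (p : ℕ) :
    IsSymplecticMap (shear v c p) := by
  set w : Coord n → Series n := fun b => MvPowerSeries.C (v b) with hw
  set τ : Series n := MvPowerSeries.C c * ((p : Series n) * linForm v ^ (p - 1)) with hτ
  have h : jacobian (shear v c p) =
      1 + Matrix.J (Fin n) (Series n) * (τ • Matrix.vecMulVec w w) := by
    rw [Matrix.mul_smul, Matrix.mul_vecMulVec]
    ext1 a b
    have hJ : MvPowerSeries.pderiv ℝ b ((Matrix.J (Fin n) (Series n)).mulVec w a) = 0 := by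
      rw [hw, J_mulVec_C, MvPowerSeries.pderiv_C]
    simp only [jacobian, shear, Matrix.of_apply, map_add, Derivation.leibniz, ← hw, hJ,
      MvPowerSeries.pderiv_pow, MvPowerSeries.pderiv_C, pderiv_linForm, MvPowerSeries.pderiv_X,
      Matrix.add_apply, Matrix.one_apply, Matrix.smul_apply, Matrix.vecMulVec_apply, smul_eq_mul,
      Pi.single_apply, hτ]
    simp only [hw]
    ring_nf
  rw [IsSymplecticMap, h]
  refine one_add_J_mul_mem_symplecticGroup ?_ ?_
  · rw [Matrix.transpose_smul, Matrix.transpose_vecMulVec]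
  · rw [Matrix.smul_mul, Matrix.smul_mul, Matrix.mul_smul, Matrix.mul_assoc,
      Matrix.mul_vecMulVec, Matrix.vecMulVec_mul_vecMulVec, dotProduct_J_mulVec_self]
    simp

/-- A shear preserves its linear form, because `⟨v, Jv⟩ = 0`. -/
theorem subst_shear_linForm (v : Coord n → ℝ) (c : ℝ) {p : ℕ} (hp : 1 ≤ p) :
    MvPowerSeries.subst (shear v c p) (linForm v) = linForm v := by
  have hs := (startsAtDegree_shear v c hp).hasSubst
  have h0 := dotProduct_J_mulVec_self (fun b => (MvPowerSeries.C (v b) : Series n))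
  conv_lhs => rw [linForm]
  simp only [← MvPowerSeries.substAlgHom_apply (R := ℝ) hs, map_sum, map_mul,
    MvPowerSeries.substAlgHom_X]
  simp only [MvPowerSeries.substAlgHom_apply, MvPowerSeries.subst_C]
  simp only [shear, mul_add, Finset.sum_add_distrib]
  simp only [← mul_assoc, ← Finset.sum_mul]
  rw [dotProduct] at h0
  rw [h0]
  simp [linForm]

theorem comp_shear_neg (v : Coord n → ℝ) (c : ℝ) {p : ℕ} (hp : 1 ≤ p) :
    comp (shear v c p) (shear v (-c) p) = idMap n := by
  have hs := (startsAtDegree_shear v (-c) hp).hasSubst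
  have hl := subst_shear_linForm v (-c) hp
  funext a
  have hJ := J_mulVec_C v a
  simp only [comp, idMap]
  rw [shear, hJ]
  rw [MvPowerSeries.subst_add hs, MvPowerSeries.subst_mul hs, MvPowerSeries.subst_mul hs,
    MvPowerSeries.subst_pow hs, MvPowerSeries.subst_X hs, MvPowerSeries.subst_C,
    MvPowerSeries.subst_C, hl, shear, hJ]
  simp

/-- If a polynomial with coefficients in a vector space takes its values in a subspace, its
coefficients lie in this subspace. -/
theorem mem_of_forall_sum_pow_smul_mem {V : Type*} [AddCommGroup V] [Module ℝ V]
    (W : Submodule ℝ V) (N : ℕ) (u : ℕ → V)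
    (h : ∀ t : ℝ, ∑ k ∈ Finset.range N, t ^ k • u k ∈ W) {k : ℕ} (hk : k < N) : u k ∈ W := by
  by_contra hu
  obtain ⟨f, hf, hW⟩ := Submodule.exists_le_ker_of_notMem hu
  apply hf
  have hp : (∑ k ∈ Finset.range N, Polynomial.C (f (u k)) * Polynomial.X ^ k) = 0 := by
    refine Polynomial.funext fun t => ?_
    have := hW (h t)
    rw [LinearMap.mem_ker, map_sum] at this
    simp only [map_smul, smul_eq_mul] at this
    simp only [Polynomial.eval_finsetSum, Polynomial.eval_mul, Polynomial.eval_C,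
      Polynomial.eval_pow, Polynomial.eval_X, Polynomial.eval_zero]
    rw [← this]
    exact Finset.sum_congr rfl fun _ _ => mul_comm _ _
  have := congrArg (fun q => Polynomial.coeff q k) hp
  simpa [Polynomial.finsetSum_coeff, Polynomial.coeff_C_mul, Polynomial.coeff_X_pow, hk] using this

/-- The product of a power `ℓ ^ m` and a variable `x` is, up to a factor, the coefficient of `t` in
`(ℓ + t x) ^ (m + 1)`. Hence the powers of linear forms span the homogeneous polynomials. -/
theorem X_mul_mem_span_linForm_pow (m : ℕ) (a : Coord n) {f : Series n}
    (hf : f ∈ Submodule.span ℝ (Set.range fun v : Coord n → ℝ => linForm v ^ m)) :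
    MvPowerSeries.X a * f ∈
      Submodule.span ℝ (Set.range fun v : Coord n → ℝ => linForm v ^ (m + 1)) := by
  induction hf using Submodule.span_induction with
  | zero => simp
  | add x y _ _ hx hy => rw [mul_add]; exact add_mem hx hy
  | smul c x _ hx => rw [mul_smul_comm]; exact Submodule.smul_mem _ _ hx
  | mem x hx =>
    obtain ⟨v, rfl⟩ := hx
    have h := mem_of_forall_sum_pow_smul_mem
      (Submodule.span ℝ (Set.range fun v : Coord n → ℝ => (linForm v ^ (m + 1) : Series n)))
      (m + 1 + 1) (fun k => ((m + 1).choose k : ℝ) •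
        ((MvPowerSeries.X a : Series n) ^ k * linForm v ^ (m + 1 - k))) ?_ (k := 1) (by omega)
    · have hm : (((m + 1 : ℕ) : ℝ)) ≠ 0 := by positivity
      simp only [Nat.choose_one_right, pow_one, Nat.add_sub_cancel] at h
      have := Submodule.smul_mem _ (((m + 1 : ℕ) : ℝ))⁻¹ h
      rwa [smul_smul, inv_mul_cancel₀ hm, one_smul] at this
    · intro t
      refine Submodule.subset_span ⟨v + t • Pi.single a 1, ?_⟩
      have : (linForm (v + t • Pi.single a 1) : Series n) =
          t • MvPowerSeries.X a + linForm v := by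
        simp only [linForm, Pi.add_apply, map_add, add_mul, Finset.sum_add_distrib,
          MvPowerSeries.smul_eq_C_mul, Pi.smul_apply, smul_eq_mul, map_mul, Pi.single_apply]
        rw [add_comm, Finset.sum_eq_single a]
        · simp
        · intro b _ hb
          simp [hb]
        · simp
      simp only [this]
      rw [add_pow]
      refine Finset.sum_congr rfl fun k _ => ?_
      simp only [MvPowerSeries.smul_eq_C_mul, map_pow, map_natCast]
      ring

/-- There is an invertible symplectic map `S` with `S(z) = z + J ∇K(z)` up to terms of degree at
least `m`. -/
def Generates (m : ℕ) (K : Series n) : Prop :=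
  ∃ S S' : FormalMap n, StartsAtDegree 1 S ∧ StartsAtDegree 1 S' ∧ comp S S' = idMap n ∧
    comp S' S = idMap n ∧ IsSymplecticMap S ∧ CongrMod m S (idMap n + hamField K)

theorem Generates.congr {m : ℕ} {K L : Series n} (hK : Generates m K)
    (h : L - K ∈ orderIdeal (Coord n) ℝ (m + 1)) : Generates m L := by
  obtain ⟨S, S', h1, h2, h3, h4, h5, h6⟩ := hK
  refine ⟨S, S', h1, h2, h3, h4, h5, h6.trans ((CongrMod.refl _ _).add fun a => ?_)⟩
  have := startsAtDegree_hamField h a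
  rw [hamField_sub, Pi.sub_apply] at this
  rw [← neg_sub]
  exact (orderIdeal (Coord n) ℝ m).neg_mem this

/-- The composition of the maps generated by `K` and `L` is generated, to leading order, by
`K + L`. -/
theorem Generates.add {m : ℕ} {K L : Series n} (hK : Generates (m + 3) K)
    (hL : Generates (m + 3) L)
    (hKm : K ∈ orderIdeal (Coord n) ℝ (m + 3)) (hLm : L ∈ orderIdeal (Coord n) ℝ (m + 3)) :
    Generates (m + 3) (K + L) := by
  obtain ⟨S, S', h1, h2, h3, h4, h5, h6⟩ := hK
  obtain ⟨T, T', k1, k2, k3, k4, k5, k6⟩ := hL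
  refine ⟨comp S T, comp T' S', h1.comp k1, k2.comp h2, ?_, ?_, h5.comp k5 k1, ?_⟩
  · rw [comp_assoc S k1 (k2.comp h2), ← comp_assoc T k2 h2, k3, idMap_comp h2, h3]
  · rw [comp_assoc T' h2 (h1.comp k1), ← comp_assoc S' h1 k1, h4, idMap_comp k1, k4]
  · have hX : StartsAtDegree (m + 1 + 1) (hamField K) := startsAtDegree_hamField hKm
    have hT : CongrMod 2 T (idMap n) := by
      refine (k6.mono (by omega)).trans fun a => ?_
      rw [Pi.add_apply, add_sub_cancel_left]
      exact (startsAtDegree_hamField hLm).mono (by omega) a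
    have e1 := h6.comp_right k1
    rw [add_comp _ _ k1, idMap_comp k1] at e1
    have e2 := CongrMod.comp_left_add hX k1 startsAtDegree_idMap hT
    rw [comp_idMap] at e2
    refine e1.trans ((k6.add (e2.mono (by omega))).trans ?_)
    rw [hamField_add, add_assoc, add_comm (hamField L)]
    exact CongrMod.refl _ _

theorem generates_smul_linForm_pow (v : Coord n → ℝ) (c : ℝ) (m : ℕ) :
    Generates (m + 3) (c • linForm v ^ (m + 3) : Series n) := by
  refine ⟨shear v (c * (m + 3)) (m + 2), shear v (-(c * (m + 3))) (m + 2),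
    startsAtDegree_shear _ _ (by omega), startsAtDegree_shear _ _ (by omega),
    comp_shear_neg _ _ (by omega), ?_, isSymplecticMap_shear _ _ _, ?_⟩
  · have := comp_shear_neg (n := n) v (-(c * (m + 3))) (p := m + 2) (by omega)
    rwa [neg_neg] at this
  · convert CongrMod.refl _ _ using 1
    funext a
    simp only [Pi.add_apply, shear, idMap, hamField, Matrix.mulVec, dotProduct, Finset.sum_mul]
    congr 1
    refine Finset.sum_congr rfl fun b _ => ?_
    have hd : MvPowerSeries.pderiv ℝ b (c • linForm v ^ (m + 3) : Series n) =
        c • (((m + 3 : ℕ) : Series n) * linForm v ^ (m + 2) * MvPowerSeries.C (v b)) := by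
      rw [Derivation.map_smul, MvPowerSeries.pderiv_pow, pderiv_linForm]
      rfl
    simp only [seriesGradient]
    rw [hd]
    simp only [MvPowerSeries.smul_eq_C_mul, map_mul, map_add, map_natCast]
    have : (MvPowerSeries.C (3 : ℝ) : Series n) = 3 := map_ofNat _ 3
    rw [this]
    push_cast
    ring

/-- The leading part of a Hamiltonian that starts at degree at least `3` is a sum of powers of
linear forms, and a composition of shears realizes it. -/
theorem generates_of_mem {m : ℕ} {K : Series n}
    (hK : K ∈ orderIdeal (Coord n) ℝ (m + 3)) : Generates (m + 3) K := by
  obtain ⟨g, hg, hKg⟩ := exists_mem_sub_mem_orderIdeal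
    (fun m => Submodule.span ℝ (Set.range fun v : Coord n → ℝ => (linForm v ^ m : Series n)))
    (Submodule.subset_span ⟨0, by simp⟩) (fun m a f hf => X_mul_mem_span_linForm_pow m a hf) hK
  refine Generates.congr ?_ hKg
  clear hKg
  suffices h : ∀ c : ℝ, c • g ∈ orderIdeal (Coord n) ℝ (m + 3) ∧ Generates (m + 3) (c • g) by
    simpa using (h 1).2
  induction hg using Submodule.span_induction with
  | zero =>
    intro c
    rw [smul_zero, ← zero_smul ℝ (linForm (0 : Coord n → ℝ) ^ (m + 3))]
    refine ⟨by simp, generates_smul_linForm_pow _ _ _⟩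
  | add x y _ _ hx hy =>
    intro c
    rw [smul_add]
    exact ⟨add_mem (hx c).1 (hy c).1, (hx c).2.add (hy c).2 (hx c).1 (hy c).1⟩
  | smul b x _ hx => intro c; rw [smul_smul]; exact hx _
  | mem x hx =>
    intro c
    obtain ⟨v, rfl⟩ := hx
    refine ⟨?_, generates_smul_linForm_pow _ _ _⟩
    rw [MvPowerSeries.smul_eq_C_mul]
    refine Ideal.mul_mem_left _ _ ?_
    simpa using pow_mem_orderIdeal (linForm_mem v) (m + 3)

/-! ### Rotations by angles depending on the actions -/

/-- The block rotation matrix with cosines `c` and sines `s`. -/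
def blockRotation {R : Type*} [CommRing R] (c s : Fin n → R) : Matrix (Coord n) (Coord n) R :=
  Matrix.fromBlocks (Matrix.diagonal c) (-Matrix.diagonal s) (Matrix.diagonal s)
    (Matrix.diagonal c)

theorem blockRotation_mulVec_inl {R : Type*} [CommRing R] (c s : Fin n → R) (w : Coord n → R)
    (j : Fin n) : (blockRotation c s).mulVec w (Sum.inl j) =
      c j * w (Sum.inl j) - s j * w (Sum.inr j) := by
  rw [blockRotation, Matrix.fromBlocks_mulVec]
  simp [Matrix.mulVec_diagonal, sub_eq_add_neg]

theorem blockRotation_mulVec_inr {R : Type*} [CommRing R] (c s : Fin n → R) (w : Coord n → R)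
    (j : Fin n) : (blockRotation c s).mulVec w (Sum.inr j) =
      s j * w (Sum.inl j) + c j * w (Sum.inr j) := by
  rw [blockRotation, Matrix.fromBlocks_mulVec]
  simp [Matrix.mulVec_diagonal]

theorem blockRotation_mem_symplecticGroup {R : Type*} [CommRing R] {c s : Fin n → R}
    (h : ∀ j, c j ^ 2 + s j ^ 2 = 1) :
    blockRotation c s ∈ Matrix.symplecticGroup (Fin n) R := by
  rw [SymplecticGroup.mem_iff, blockRotation, Matrix.J, Matrix.fromBlocks_transpose,
    Matrix.fromBlocks_multiply, Matrix.fromBlocks_multiply]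
  have h' : ∀ j, c j * c j + s j * s j = 1 := fun j => by rw [← h j]; ring
  have h'' : ∀ j, s j * s j + c j * c j = 1 := fun j => by rw [← h j]; ring
  congr 1
  · simp [Matrix.diagonal_mul_diagonal, mul_comm]
  · simp only [Matrix.diagonal_transpose, Matrix.mul_zero, Matrix.mul_one, Matrix.mul_neg,
      Matrix.neg_mul, Matrix.diagonal_mul_diagonal, zero_add, add_zero]
    rw [← Matrix.diagonal_one, ← neg_add, Matrix.diagonal_add]
    congr 2
    funext j
    rw [← h'' j]
  · simp only [Matrix.transpose_neg, Matrix.diagonal_transpose, Matrix.mul_zero,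
      Matrix.mul_one, Matrix.mul_neg, Matrix.neg_mul, Matrix.diagonal_mul_diagonal, zero_add,
      add_zero, neg_neg]
    rw [← Matrix.diagonal_one,  Matrix.diagonal_add]
    congr 1
    funext j
    rw [← h' j]
  · simp [Matrix.diagonal_mul_diagonal, mul_comm]

/-- The index of the action to which a coordinate belongs. -/
def actionIndex : Coord n → Fin n := Sum.elim id id

theorem C_half_mul_two : (MvPowerSeries.C (1 / 2 : ℝ) : Series n) * 2 = 1 := by
  rw [← map_ofNat (MvPowerSeries.C (σ := Coord n) (R := ℝ)) 2, ← map_mul]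
  simp

theorem pderiv_actionVar_inl (j k : Fin n) :
    MvPowerSeries.pderiv ℝ (Sum.inl j) (actionVar k) =
      if k = j then MvPowerSeries.X (Sum.inl j) else 0 := by
  have h2 := C_half_mul_two (n := n)
  rw [actionVar, Derivation.leibniz, MvPowerSeries.pderiv_C, map_add, MvPowerSeries.pderiv_pow,
    MvPowerSeries.pderiv_pow, MvPowerSeries.pderiv_X, MvPowerSeries.pderiv_X]
  simp only [Pi.single_apply, Sum.inl.injEq, reduceCtorEq, if_false, smul_eq_mul]
  split_ifs with h
  · subst h
    linear_combination MvPowerSeries.X (Sum.inl k) * h2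
  · ring

theorem pderiv_actionVar_inr (j k : Fin n) :
    MvPowerSeries.pderiv ℝ (Sum.inr j) (actionVar k) =
      if k = j then MvPowerSeries.X (Sum.inr j) else 0 := by
  have h2 := C_half_mul_two (n := n)
  rw [actionVar, Derivation.leibniz, MvPowerSeries.pderiv_C, map_add, MvPowerSeries.pderiv_pow,
    MvPowerSeries.pderiv_pow, MvPowerSeries.pderiv_X, MvPowerSeries.pderiv_X]
  simp only [Pi.single_apply, Sum.inr.injEq, reduceCtorEq, if_false, smul_eq_mul]
  split_ifs with h
  · subst h
    linear_combination MvPowerSeries.X (Sum.inr k) * h2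
  · ring

theorem pderiv_actionVar (a : Coord n) (k : Fin n) :
    MvPowerSeries.pderiv ℝ a (actionVar k) =
      if k = actionIndex a then MvPowerSeries.X a else 0 := by
  rcases a with j | j
  · exact pderiv_actionVar_inl j k
  · exact pderiv_actionVar_inr j k

theorem actionVar_mem (j : Fin n) : actionVar j ∈ orderIdeal (Coord n) ℝ 2 :=
  Ideal.mul_mem_left _ _ (add_mem (by simpa using pow_mem_orderIdeal (X_mem_orderIdeal _) 2)
    (by simpa using pow_mem_orderIdeal (X_mem_orderIdeal _) 2))

theorem actionVar_mem_one (j : Fin n) : actionVar j ∈ orderIdeal (Coord n) ℝ 1 :=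
  orderIdeal_anti one_le_two (actionVar_mem j)

theorem hasSubst_actionVar : MvPowerSeries.HasSubst (actionVar (n := n)) :=
  hasSubst_of_mem_orderIdeal actionVar_mem_one

/-- The evaluation of a power series at the actions. -/
def evalActions (n : ℕ) : ActionSeries n →ₐ[ℝ] Series n :=
  MvPowerSeries.substAlgHom (hasSubst_actionVar (n := n))

theorem evalActions_apply (f : ActionSeries n) :
    evalActions n f = MvPowerSeries.subst actionVar f :=
  MvPowerSeries.substAlgHom_apply _ f

theorem evalActions_C (r : ℝ) : evalActions n (MvPowerSeries.C r) = MvPowerSeries.C r := by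
  rw [evalActions_apply, MvPowerSeries.subst_C]

theorem evalActions_mem {p : ℕ} {f : ActionSeries n} (hf : f ∈ orderIdeal (Fin n) ℝ p) :
    evalActions n f ∈ orderIdeal (Coord n) ℝ (2 * p) := by
  rw [evalActions_apply]
  exact subst_mem_orderIdeal actionVar_mem_one actionVar_mem hf

theorem pderiv_evalActions (f : ActionSeries n) (a : Coord n) :
    MvPowerSeries.pderiv ℝ a (evalActions n f) =
      evalActions n (MvPowerSeries.pderiv ℝ (actionIndex a) f) * MvPowerSeries.X a := by
  rw [evalActions_apply, pderiv_subst actionVar_mem_one]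
  simp [pderiv_actionVar, evalActions_apply]

theorem actionMap_eq_mulVec (Ω : Matrix (Coord n) (Coord n) (ActionSeries n)) :
    actionMap Ω = (Ω.map (evalActions n)).mulVec MvPowerSeries.X := by
  funext a
  simp only [actionMap, Matrix.mulVec, dotProduct, Matrix.map_apply, evalActions_apply]

theorem blockRotation_map {R S : Type*} [CommRing R] [CommRing S] (φ : R →+* S)
    (c s : Fin n → R) :
    (blockRotation c s).map φ = blockRotation (fun j => φ (c j)) (fun j => φ (s j)) := by
  simp [blockRotation, Matrix.fromBlocks_map, Matrix.diagonal_map]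

theorem actionMap_blockRotation (c s : Fin n → ActionSeries n) :
    actionMap (blockRotation c s) =
      (blockRotation (fun j => evalActions n (c j)) (fun j => evalActions n (s j))).mulVec
        MvPowerSeries.X := by
  rw [actionMap_eq_mulVec]
  congr 1
  exact blockRotation_map (evalActions n).toRingHom c s

/-- The families `c`, `s` are the cosines and sines of angles whose matrix of partial derivatives
`η` is symmetric: the angles are of the form `ω_j + ∂h/∂I_j`, but neither they nor `h` are part of
the data. -/
structure IsAngleData (c s : Fin n → ActionSeries n) : Prop where
  sq_add_sq : ∀ j, c j ^ 2 + s j ^ 2 = 1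
  exists_symm : ∃ η : Fin n → Fin n → ActionSeries n, (∀ j k, η j k = η k j) ∧
    (∀ j k, MvPowerSeries.pderiv ℝ k (c j) = -(s j * η j k)) ∧
    ∀ j k, MvPowerSeries.pderiv ℝ k (s j) = c j * η j k

/-- Angle data are multiplied as the complex numbers `c + i s`: the angles add. -/
theorem IsAngleData.mul {c s c' s' : Fin n → ActionSeries n} (h : IsAngleData c s)
    (h' : IsAngleData c' s') : IsAngleData (c * c' - s * s') (s * c' + c * s') := by
  obtain ⟨h1, η, h2, h3, h4⟩ := h
  obtain ⟨h1', η', h2', h3', h4'⟩ := h'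
  refine ⟨fun j => ?_, fun j k => η j k + η' j k, fun j k => by simp only [h2 j, h2' j],
    fun j k => ?_, fun j k => ?_⟩
  · simp only [Pi.sub_apply, Pi.mul_apply, Pi.add_apply]
    linear_combination (c' j ^ 2 + s' j ^ 2) * h1 j + h1' j
  · simp only [Pi.sub_apply, Pi.mul_apply, Pi.add_apply, map_sub, Derivation.leibniz, smul_eq_mul,
      h3, h4, h3', h4']
    ring
  · simp only [Pi.sub_apply, Pi.mul_apply, Pi.add_apply, map_add, Derivation.leibniz, smul_eq_mul,
      h3, h4, h3', h4']
    ring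

/-- The Jacobian matrix is the product of the rotation by the matrix `1 + J B`, where
`B_{ab} = z_a η_{ab} z_b`. -/
theorem IsAngleData.isSymplecticMap {c s : Fin n → ActionSeries n} (h : IsAngleData c s) :
    IsSymplecticMap (actionMap (blockRotation c s)) := by
  obtain ⟨h1, η, h2, h3, h4⟩ := h
  let B : Matrix (Coord n) (Coord n) (Series n) := Matrix.of fun a b =>
    MvPowerSeries.X a * evalActions n (η (actionIndex a) (actionIndex b)) * MvPowerSeries.X b
  have hBl : ∀ j b, (Matrix.J (Fin n) (Series n) * B) (Sum.inl j) b = - B (Sum.inr j) b := by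
    intro j b
    simp [Matrix.J, Matrix.mul_apply, Fintype.sum_sum_type, Matrix.one_apply]
  have hBr : ∀ j b, (Matrix.J (Fin n) (Series n) * B) (Sum.inr j) b = B (Sum.inl j) b := by
    intro j b
    simp [Matrix.J, Matrix.mul_apply, Fintype.sum_sum_type, Matrix.one_apply]
  have hJ : jacobian (actionMap (blockRotation c s)) =
      blockRotation (fun j => evalActions n (c j)) (fun j => evalActions n (s j)) *
        (1 + Matrix.J (Fin n) (Series n) * B) := by
    ext1 a b
    change _ = (blockRotation _ _).mulVec (fun d => _) a
    rcases a with j | j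
    · rw [blockRotation_mulVec_inl, jacobian, Matrix.of_apply, actionMap_blockRotation,
        blockRotation_mulVec_inl]
      simp only [map_sub, Derivation.leibniz, smul_eq_mul, pderiv_evalActions, h3, h4, map_neg,
        map_mul, MvPowerSeries.pderiv_X, Pi.single_apply, Matrix.add_apply, Matrix.one_apply,
        hBl, hBr]
      simp only [B, Matrix.of_apply, actionIndex, Sum.elim_inl, Sum.elim_inr, id]
      ring
    · rw [blockRotation_mulVec_inr, jacobian, Matrix.of_apply, actionMap_blockRotation,
        blockRotation_mulVec_inr]
      simp only [map_add, Derivation.leibniz, smul_eq_mul, pderiv_evalActions, h3, h4, map_neg,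
        map_mul, MvPowerSeries.pderiv_X, Pi.single_apply, Matrix.add_apply, Matrix.one_apply,
        hBl, hBr]
      simp only [B, Matrix.of_apply, actionIndex, Sum.elim_inl, Sum.elim_inr, id]
      ring
  rw [IsSymplecticMap, hJ]
  refine mul_mem (blockRotation_mem_symplecticGroup fun j => ?_)
    (one_add_J_mul_mem_symplecticGroup ?_ ?_)
  · rw [← map_pow, ← map_pow, ← map_add, h1, map_one]
  · ext1 a b
    simp only [B, Matrix.transpose_apply, Matrix.of_apply, h2 (actionIndex b)]
    ring
  · ext1 a b
    rw [Matrix.mul_assoc, Matrix.mul_apply, Fintype.sum_sum_type, ← Finset.sum_add_distrib]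
    refine Finset.sum_eq_zero fun k _ => ?_
    rw [hBl, hBr]
    simp only [B, Matrix.of_apply, actionIndex, Sum.elim_inl, Sum.elim_inr, id]
    ring

theorem startsAtDegree_actionMap (Ω : Matrix (Coord n) (Coord n) (ActionSeries n)) :
    StartsAtDegree 1 (actionMap Ω) := fun a => by
  change ∑ b, MvPowerSeries.subst (actionVar (n := n)) (Ω a b) * MvPowerSeries.X b ∈
    orderIdeal (Coord n) ℝ 1
  exact Ideal.sum_mem _ fun b _ => Ideal.mul_mem_left _ _ (X_mem_orderIdeal b)

/-- The map rotates each pair `(x_j, y_j)`, hence preserves the actions. -/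
theorem IsAngleData.isIntegrableWith {c s : Fin n → ActionSeries n} (h : IsAngleData c s) :
    IsIntegrableWith (actionMap (blockRotation c s)) actionVar where
  symplectic := h.isSymplecticMap
  invariant j := by
    have hs := (startsAtDegree_actionMap (blockRotation c s)).hasSubst
    have h1 : evalActions n (c j) ^ 2 + evalActions n (s j) ^ 2 = 1 := by
      rw [← map_pow, ← map_pow, ← map_add, h.sq_add_sq, map_one]
    rw [pullback, actionVar, MvPowerSeries.subst_mul hs, MvPowerSeries.subst_add hs,
      MvPowerSeries.subst_pow hs, MvPowerSeries.subst_pow hs, MvPowerSeries.subst_X hs,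
      MvPowerSeries.subst_X hs, MvPowerSeries.subst_C, actionMap_blockRotation,
      blockRotation_mulVec_inl, blockRotation_mulVec_inr]
    linear_combination (MvPowerSeries.C (1 / 2 : ℝ)) * (MvPowerSeries.X (Sum.inl j) ^ 2 +
      MvPowerSeries.X (Sum.inr j) ^ 2) * h1
  involution i j := by
    refine Finset.sum_eq_zero fun k _ => ?_
    simp only [pderiv_actionVar_inl, pderiv_actionVar_inr]
    split_ifs <;> ring
  independent := by
    rw [Fintype.linearIndependent_iff]
    intro g hg j
    have := congrFun hg (Sum.inl j)
    simp only [Finset.sum_apply, Pi.smul_apply, seriesGradient, pderiv_actionVar_inl,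
      smul_eq_mul, mul_ite, mul_zero, Finset.sum_ite_eq', Finset.mem_univ,
      if_true, Pi.zero_apply] at this
    refine (mul_eq_zero.1 this).resolve_right fun h0 => ?_
    have := congrArg (MvPowerSeries.coeff (Finsupp.single (Sum.inl j) 1)) h0
    simp at this

/-! ### Trigonometric power series and variation of the angles -/

theorem pderiv_comm {σ R : Type*} [CommRing R] (a b : σ) (f : MvPowerSeries σ R) :
    MvPowerSeries.pderiv R a (MvPowerSeries.pderiv R b f) =
      MvPowerSeries.pderiv R b (MvPowerSeries.pderiv R a f) := by
  classical
  by_cases h : a = b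
  · rw [h]
  · ext d
    simp only [MvPowerSeries.coeff_pderiv, Finsupp.add_apply, Finsupp.single_apply, h, Ne.symm h,
      if_false, add_zero]
    rw [add_right_comm]
    ring

theorem pderiv_sin : MvPowerSeries.pderiv ℝ () (PowerSeries.sin ℝ) = PowerSeries.cos ℝ := by
  change PowerSeries.derivative ℝ (PowerSeries.sin ℝ) = _
  ext k
  rw [PowerSeries.coeff_derivative, PowerSeries.sin, PowerSeries.cos, PowerSeries.coeff_mk,
    PowerSeries.coeff_mk]
  rcases Nat.even_or_odd k with h | h
  · have h' : ¬ Even (k + 1) := by simpa [Nat.even_add_one] using h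
    have h2 : (k + 1) / 2 = k / 2 := by obtain ⟨r, rfl⟩ := h; omega
    rw [if_neg h', if_pos h, h2, Nat.factorial_succ]
    have : ((k : ℝ) + 1) ≠ 0 := by positivity
    simp
    field_simp
  · have h' : Even (k + 1) := h.add_one
    rw [if_pos h', if_neg (Nat.not_even_iff_odd.2 h), zero_mul]

theorem pderiv_cos : MvPowerSeries.pderiv ℝ () (PowerSeries.cos ℝ) = -PowerSeries.sin ℝ := by
  change PowerSeries.derivative ℝ (PowerSeries.cos ℝ) = _
  ext k
  rw [PowerSeries.coeff_derivative, map_neg, PowerSeries.sin, PowerSeries.cos,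
    PowerSeries.coeff_mk, PowerSeries.coeff_mk]
  rcases Nat.even_or_odd k with h | h
  · have h' : ¬ Even (k + 1) := by simpa [Nat.even_add_one] using h
    rw [if_neg h', if_pos h]
    simp
  · have h' : Even (k + 1) := h.add_one
    have h2 : (k + 1) / 2 = k / 2 + 1 := by obtain ⟨r, rfl⟩ := h; omega
    rw [if_pos h', if_neg (Nat.not_even_iff_odd.2 h), h2, Nat.factorial_succ]
    have : ((k : ℝ) + 1) ≠ 0 := by positivity
    simp
    field_simp
    ring

theorem constantCoeff_cos : MvPowerSeries.constantCoeff (PowerSeries.cos ℝ) = 1 := by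
  change PowerSeries.constantCoeff (PowerSeries.cos ℝ) = 1
  rw [← PowerSeries.coeff_zero_eq_constantCoeff_apply, PowerSeries.cos, PowerSeries.coeff_mk]
  simp

theorem constantCoeff_sin : MvPowerSeries.constantCoeff (PowerSeries.sin ℝ) = 0 := by
  change PowerSeries.constantCoeff (PowerSeries.sin ℝ) = 0
  rw [← PowerSeries.coeff_zero_eq_constantCoeff_apply, PowerSeries.sin, PowerSeries.coeff_mk]
  simp

theorem cos_sq_add_sin_sq : PowerSeries.cos ℝ ^ 2 + PowerSeries.sin ℝ ^ 2 = 1 := by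
  refine MvPowerSeries.pderiv.ext (fun i => ?_) ?_
  · rw [map_add, MvPowerSeries.pderiv_pow, MvPowerSeries.pderiv_pow, MvPowerSeries.pderiv_one]
    have h1 := pderiv_sin
    have h2 := pderiv_cos
    cases i
    rw [h1, h2]
    ring
  · rw [map_add, map_pow, map_pow, constantCoeff_cos, constantCoeff_sin]
    simp

/-- A power series without constant term whose partial derivatives start at degree `m` starts at
degree `m + 1`. -/
theorem mem_orderIdeal_succ_of_pderiv {σ : Type*} {m : ℕ} {f : MvPowerSeries σ ℝ}
    (h0 : f ∈ orderIdeal σ ℝ 1) (h : ∀ a, MvPowerSeries.pderiv ℝ a f ∈ orderIdeal σ ℝ m) :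
    f ∈ orderIdeal σ ℝ (m + 1) := by
  rw [mem_orderIdeal_iff_coeff]
  intro d hd
  by_cases hd0 : d = 0
  · subst hd0
    exact mem_orderIdeal_one.1 h0
  · obtain ⟨a, ha⟩ : ∃ a, d a ≠ 0 := by
      by_contra! h; exact hd0 (Finsupp.ext h)
    obtain ⟨e, rfl⟩ := exists_add_of_le (Finsupp.single_le_iff.2 (Nat.one_le_iff_ne_zero.2 ha))
    have := mem_orderIdeal_iff_coeff.1 (h a) e (by
      simp only [map_add, Finsupp.degree_single] at hd
      omega)
    rw [MvPowerSeries.coeff_pderiv, add_comm] at this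
    exact (mul_eq_zero.1 this).resolve_right (by positivity)

theorem cos_sub_one_mem : PowerSeries.cos ℝ - 1 ∈ orderIdeal Unit ℝ 2 := by
  refine mem_orderIdeal_succ_of_pderiv ?_ fun a => ?_
  · rw [mem_orderIdeal_one, map_sub, constantCoeff_cos, map_one, sub_self]
  · cases a
    rw [map_sub, MvPowerSeries.pderiv_one, sub_zero, pderiv_cos, mem_orderIdeal_one, map_neg,
      constantCoeff_sin, neg_zero]

theorem sin_sub_X_mem : PowerSeries.sin ℝ - MvPowerSeries.X () ∈ orderIdeal Unit ℝ 2 := by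
  refine mem_orderIdeal_succ_of_pderiv ?_ fun a => ?_
  · rw [mem_orderIdeal_one, map_sub, constantCoeff_sin, MvPowerSeries.constantCoeff_X, sub_self]
  · cases a
    rw [map_sub, MvPowerSeries.pderiv_X_self, pderiv_sin, mem_orderIdeal_one, map_sub,
      constantCoeff_cos, map_one, sub_self]

/-- The cosines and sines of the angles `∂k/∂I_j` produced by a Hamiltonian `k(I)`, with their
expansions to first order. -/
theorem exists_isAngleData {p : ℕ} {k : ActionSeries n} (hk : k ∈ orderIdeal (Fin n) ℝ (p + 2)) :
    ∃ c s : Fin n → ActionSeries n, IsAngleData c s ∧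
      (∀ j, c j - 1 ∈ orderIdeal (Fin n) ℝ (2 * p + 2)) ∧
      ∀ j, s j - MvPowerSeries.pderiv ℝ j k ∈ orderIdeal (Fin n) ℝ (2 * p + 2) := by
  have hβ : ∀ j, MvPowerSeries.pderiv ℝ j k ∈ orderIdeal (Fin n) ℝ (p + 1) := fun j =>
    pderiv_mem_orderIdeal hk j
  have hβ1 : ∀ j, ∀ _ : Unit, MvPowerSeries.pderiv ℝ j k ∈ orderIdeal (Fin n) ℝ 1 := fun j _ =>
    orderIdeal_anti (by omega) (hβ j)
  have hs := fun j => hasSubst_of_mem_orderIdeal (hβ1 j)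
  refine ⟨fun j => MvPowerSeries.subst (fun _ : Unit => MvPowerSeries.pderiv ℝ j k)
    (PowerSeries.cos ℝ), fun j => MvPowerSeries.subst
    (fun _ : Unit => MvPowerSeries.pderiv ℝ j k) (PowerSeries.sin ℝ), ⟨fun j => ?_,
    fun j i => MvPowerSeries.pderiv ℝ i (MvPowerSeries.pderiv ℝ j k), fun j i => pderiv_comm _ _ _,
    fun j i => ?_, fun j i => ?_⟩, fun j => ?_, fun j => ?_⟩
  · have h := congrArg (MvPowerSeries.substAlgHom (R := ℝ) (hs j)) cos_sq_add_sin_sq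
    rw [map_add, map_pow, map_pow, map_one] at h
    simpa only [MvPowerSeries.substAlgHom_apply] using h
  · have h : MvPowerSeries.substAlgHom (R := ℝ) (hs j) (-PowerSeries.sin ℝ) =
      -MvPowerSeries.substAlgHom (R := ℝ) (hs j) (PowerSeries.sin ℝ) := map_neg _ _
    rw [pderiv_subst (hβ1 j)]
    simp only [Finset.univ_unique, Finset.sum_singleton]
    change MvPowerSeries.subst _ (MvPowerSeries.pderiv ℝ () _) * _ = _
    rw [pderiv_cos, ← MvPowerSeries.substAlgHom_apply (R := ℝ) (hs j), h,
      MvPowerSeries.substAlgHom_apply, neg_mul]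
  · rw [pderiv_subst (hβ1 j)]
    simp only [Finset.univ_unique, Finset.sum_singleton]
    change MvPowerSeries.subst _ (MvPowerSeries.pderiv ℝ () _) * _ = _
    rw [pderiv_sin]
  · have h := subst_mem_orderIdeal (hβ1 j) (fun _ => hβ j) cos_sub_one_mem
    rw [MvPowerSeries.subst_sub (hs j), ← map_one MvPowerSeries.C, MvPowerSeries.subst_C,
      map_one] at h
    exact orderIdeal_anti (by omega) h
  · have h := subst_mem_orderIdeal (hβ1 j) (fun _ => hβ j) sin_sub_X_mem
    rw [MvPowerSeries.subst_sub (hs j), MvPowerSeries.subst_X (hs j)] at h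
    exact orderIdeal_anti (by omega) h

/-- The action of a constant matrix on the components of a formal map. -/
def constMulVec (A : Matrix (Coord n) (Coord n) ℝ) (W : FormalMap n) : FormalMap n :=
  (A.map (MvPowerSeries.C (σ := Coord n))).mulVec W

theorem rotationMatrix_map (ω : Fin n → ℝ) {σ : Type*} :
    (rotationMatrix ω).map (MvPowerSeries.C (σ := σ)) =
      blockRotation (fun j => MvPowerSeries.C (Real.cos (ω j)))
        fun j => MvPowerSeries.C (Real.sin (ω j)) :=
  blockRotation_map (R := ℝ) (S := MvPowerSeries σ ℝ) MvPowerSeries.C _ _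

/-- Multiplying the rotation of the normal form by the one of angles `∂k/∂I_j` adds, to leading
order, the Hamiltonian vector field of `k(I)`. -/
theorem exists_isAngleData_congrMod {ω : Fin n → ℝ} {c s : Fin n → ActionSeries n}
    (h : IsAngleData c s)
    (hc : ∀ j, c j - MvPowerSeries.C (Real.cos (ω j)) ∈ orderIdeal (Fin n) ℝ 1)
    (hs : ∀ j, s j - MvPowerSeries.C (Real.sin (ω j)) ∈ orderIdeal (Fin n) ℝ 1)
    {p m : ℕ} (hm : m ≤ 2 * p + 4) {k : ActionSeries n}
    (hk : k ∈ orderIdeal (Fin n) ℝ (p + 2)) :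
    ∃ c' s' : Fin n → ActionSeries n, IsAngleData c' s' ∧
      (∀ j, c' j - MvPowerSeries.C (Real.cos (ω j)) ∈ orderIdeal (Fin n) ℝ 1) ∧
      (∀ j, s' j - MvPowerSeries.C (Real.sin (ω j)) ∈ orderIdeal (Fin n) ℝ 1) ∧
      CongrMod m (actionMap (blockRotation c' s')) (actionMap (blockRotation c s) +
        constMulVec (rotationMatrix ω) (hamField (evalActions n k))) := by
  obtain ⟨u, v, huv, hu, hv⟩ := exists_isAngleData hk
  set β : Fin n → ActionSeries n := fun j => MvPowerSeries.pderiv ℝ j k with hβdef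
  have hβ : ∀ j, β j ∈ orderIdeal (Fin n) ℝ (p + 1) := fun j => pderiv_mem_orderIdeal hk j
  have hC : ∀ j, (c * u - s * v) j - (c j - s j * β j) ∈ orderIdeal (Fin n) ℝ (2 * p + 2) := by
    intro j
    have : (c * u - s * v) j - (c j - s j * β j) = c j * (u j - 1) - s j * (v j - β j) := by
      simp only [Pi.sub_apply, Pi.mul_apply]; ring
    rw [this]
    exact sub_mem (Ideal.mul_mem_left _ _ (hu j)) (Ideal.mul_mem_left _ _ (hv j))
  have hS : ∀ j, (s * u + c * v) j - (s j + c j * β j) ∈ orderIdeal (Fin n) ℝ (2 * p + 2) := by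
    intro j
    have : (s * u + c * v) j - (s j + c j * β j) = s j * (u j - 1) + c j * (v j - β j) := by
      simp only [Pi.add_apply, Pi.mul_apply]; ring
    rw [this]
    exact add_mem (Ideal.mul_mem_left _ _ (hu j)) (Ideal.mul_mem_left _ _ (hv j))
  have hβ1 : ∀ j, β j ∈ orderIdeal (Fin n) ℝ 1 := fun j => orderIdeal_anti (by omega) (hβ j)
  -- Each component has two error terms of each of the two kinds below, all of degree at least `m`.
  have hI : ∀ {f : ActionSeries n} (a : Coord n), f ∈ orderIdeal (Fin n) ℝ (2 * p + 2) →
      evalActions n f * MvPowerSeries.X a ∈ orderIdeal (Coord n) ℝ m := fun a hf =>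
    orderIdeal_anti (by omega) (mul_mem_orderIdeal (evalActions_mem hf) (X_mem_orderIdeal a))
  have hII : ∀ {f : ActionSeries n} (j : Fin n) (a : Coord n), f ∈ orderIdeal (Fin n) ℝ 1 →
      evalActions n f * evalActions n (β j) * MvPowerSeries.X a ∈ orderIdeal (Coord n) ℝ m :=
    fun j a hf => orderIdeal_anti (by omega) (mul_mem_orderIdeal (mul_mem_orderIdeal
      (evalActions_mem hf) (evalActions_mem (hβ j))) (X_mem_orderIdeal a))
  have hXl : ∀ j, hamField (evalActions n k) (Sum.inl j) =
      -(evalActions n (β j) * MvPowerSeries.X (Sum.inr j)) := by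
    intro j
    simp [hamField, Matrix.J, Matrix.mulVec, dotProduct, Fintype.sum_sum_type, Matrix.one_apply,
      seriesGradient, pderiv_evalActions, actionIndex, hβdef]
  have hXr : ∀ j, hamField (evalActions n k) (Sum.inr j) =
      evalActions n (β j) * MvPowerSeries.X (Sum.inl j) := by
    intro j
    simp [hamField, Matrix.J, Matrix.mulVec, dotProduct, Fintype.sum_sum_type, Matrix.one_apply,
      seriesGradient, pderiv_evalActions, actionIndex, hβdef]
  refine ⟨c * u - s * v, s * u + c * v, h.mul huv, fun j => ?_, fun j => ?_, fun a => ?_⟩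
  · have := add_mem (orderIdeal_anti (by omega) (hC j)) (sub_mem (hc j)
      (Ideal.mul_mem_left _ (s j) (hβ1 j)))
    convert this using 1
    ring
  · have := add_mem (orderIdeal_anti (by omega) (hS j)) (add_mem (hs j)
      (Ideal.mul_mem_left _ (c j) (hβ1 j)))
    convert this using 1
    ring
  · rw [Pi.add_apply, constMulVec, rotationMatrix_map, actionMap_blockRotation,
      actionMap_blockRotation]
    rcases a with j | j
    · rw [blockRotation_mulVec_inl, blockRotation_mulVec_inl, blockRotation_mulVec_inl, hXl, hXr]
      have := sub_mem (sub_mem (sub_mem (hI (Sum.inl j) (hC j)) (hI (Sum.inr j) (hS j)))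
        (hII j (Sum.inl j) (hs j))) (hII j (Sum.inr j) (hc j))
      convert this using 1
      simp only [map_sub, map_add, map_mul, evalActions_C]
      ring
    · rw [blockRotation_mulVec_inr, blockRotation_mulVec_inr, blockRotation_mulVec_inr, hXl, hXr]
      have := sub_mem (add_mem (add_mem (hI (Sum.inl j) (hS j)) (hI (Sum.inr j) (hC j)))
        (hII j (Sum.inl j) (hc j))) (hII j (Sum.inr j) (hs j))
      convert this using 1
      simp only [map_sub, map_add, map_mul, evalActions_C]
      ring

/-! ### The homological equation -/

/-- Writing a nonzero `m` as `k ± e_j` with `|k| > 1` shows that non-resonance means the absence of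
any nontrivial resonance `e^{i⟨m,ω⟩} = 1`. -/
theorem NonResonant.exp_ne_one {ω : Fin n → ℝ} (hω : NonResonant ω) {m : Fin n → ℤ}
    (hm : m ≠ 0) :
    Complex.exp (Complex.I * ((∑ l, (m l : ℝ) * ω l : ℝ) : ℂ)) ≠ 1 := by
  obtain ⟨j, hj⟩ : ∃ j, m j ≠ 0 := by
    by_contra! h; exact hm (funext h)
  let shift : ℤ → Fin n → ℤ := fun ε => m + Pi.single j ε
  -- Moving `m j` away from zero by one unit makes the norm of the multi-index at least `2`.
  have key : ∀ ε : ℤ, |m j + ε| = |m j| + 1 →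
      1 < ∑ l, |shift ε l| ∧ ∑ l, (shift ε l : ℝ) * ω l =
        ∑ l, (m l : ℝ) * ω l + ε * ω j := by
    intro ε hε
    constructor
    · have h1 : |shift ε j| ≤ ∑ l, |shift ε l| :=
        Finset.single_le_sum (f := fun l => |shift ε l|) (fun l _ => abs_nonneg _)
          (Finset.mem_univ j)
      rw [show shift ε j = m j + ε by simp [shift], hε] at h1
      have := abs_pos.2 hj
      omega
    · simp [shift, add_mul, Finset.sum_add_distrib, Pi.single_apply]
  rcases lt_or_gt_of_ne hj with hneg | hpos
  · obtain ⟨h1, h2⟩ := key (-1) (by rw [abs_of_neg hneg, abs_of_neg (by omega)]; ring)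
    have := (hω _ h1 j).1
    rw [h2] at this
    convert this using 4
    push_cast
    ring
  · obtain ⟨h1, h2⟩ := key 1 (by rw [abs_of_pos hpos, abs_of_pos (by omega)])
    have := (hω _ h1 j).2
    rw [h2] at this
    convert this using 4
    push_cast
    ring

/-- Power series with complex coefficients, as pairs of a real and an imaginary part. -/
abbrev ComplexSeries (n : ℕ) : Type := QuadraticAlgebra (Series n) (-1) 0

/-- The constant complex power series. -/
def complexConst (n : ℕ) : ℂ →+* ComplexSeries n where
  toFun z := ⟨MvPowerSeries.C z.re, MvPowerSeries.C z.im⟩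
  map_one' := by ext1 <;> simp [QuadraticAlgebra.re_one, QuadraticAlgebra.im_one]
  map_zero' := by ext1 <;> simp
  map_mul' z w := by
    ext1 <;> simp [sub_eq_add_neg, Complex.mul_re, Complex.mul_im]
  map_add' z w := by ext1 <;> simp

/-- The complex coordinate `ζ_j = x_j + i y_j`. -/
def zeta (j : Fin n) : ComplexSeries n :=
  ⟨MvPowerSeries.X (Sum.inl j), MvPowerSeries.X (Sum.inr j)⟩

/-- The complex coordinate `x_j - i y_j`. -/
def zetaBar (j : Fin n) : ComplexSeries n :=
  ⟨MvPowerSeries.X (Sum.inl j), -MvPowerSeries.X (Sum.inr j)⟩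

/-- The monomial `∏_{j ∈ A} ζ_j ∏_{j ∈ B} ζ̄_j`, with exponents given by multiplicities. -/
def zetaMonomial (A B : Multiset (Fin n)) : ComplexSeries n :=
  (A.map zeta).prod * (B.map zetaBar).prod

/-- The coefficientwise extension of an algebra endomorphism to complex power series. -/
def complexify (T : Series n →ₐ[ℝ] Series n) : ComplexSeries n →+* ComplexSeries n where
  toFun w := ⟨T w.re, T w.im⟩
  map_one' := by ext1 <;> simp [QuadraticAlgebra.re_one, QuadraticAlgebra.im_one]
  map_zero' := by ext1 <;> simp
  map_mul' z w := by ext1 <;> simp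
  map_add' z w := by ext1 <;> simp

theorem zetaMonomial_cons_left (j : Fin n) (A B : Multiset (Fin n)) :
    zetaMonomial (j ::ₘ A) B = zeta j * zetaMonomial A B := by
  simp [zetaMonomial, mul_assoc]

theorem zetaMonomial_cons_right (j : Fin n) (A B : Multiset (Fin n)) :
    zetaMonomial A (j ::ₘ B) = zetaBar j * zetaMonomial A B := by
  simp [zetaMonomial, mul_left_comm]

theorem complexSeries_mul_mem {p q : ℕ} {u w : ComplexSeries n}
    (hu : u.re ∈ orderIdeal (Coord n) ℝ p ∧ u.im ∈ orderIdeal (Coord n) ℝ p)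
    (hw : w.re ∈ orderIdeal (Coord n) ℝ q ∧ w.im ∈ orderIdeal (Coord n) ℝ q) :
    (u * w).re ∈ orderIdeal (Coord n) ℝ (p + q) ∧
      (u * w).im ∈ orderIdeal (Coord n) ℝ (p + q) := by
  rw [QuadraticAlgebra.re_mul, QuadraticAlgebra.im_mul, zero_mul, zero_mul, add_zero, mul_assoc]
  exact ⟨add_mem (mul_mem_orderIdeal hu.1 hw.1)
    (Ideal.mul_mem_left _ _ (mul_mem_orderIdeal hu.2 hw.2)),
    add_mem (mul_mem_orderIdeal hu.1 hw.2) (mul_mem_orderIdeal hu.2 hw.1)⟩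

theorem zetaMonomial_mem (A B : Multiset (Fin n)) :
    (zetaMonomial A B).re ∈ orderIdeal (Coord n) ℝ (A.card + B.card) ∧
      (zetaMonomial A B).im ∈ orderIdeal (Coord n) ℝ (A.card + B.card) := by
  induction A using Multiset.induction_on with
  | empty =>
    induction B using Multiset.induction_on with
    | empty => exact ⟨mem_orderIdeal_zero _, mem_orderIdeal_zero _⟩
    | cons j B ih =>
      rw [zetaMonomial_cons_right, Multiset.card_cons, ← add_assoc, add_comm _ 1]
      exact complexSeries_mul_mem ⟨X_mem_orderIdeal _, neg_mem (X_mem_orderIdeal _)⟩ ih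
  | cons j A ih =>
    rw [zetaMonomial_cons_left, Multiset.card_cons, add_right_comm, add_comm _ 1]
    exact complexSeries_mul_mem ⟨X_mem_orderIdeal _, X_mem_orderIdeal _⟩ ih

theorem re_complexConst_mul_mem (c : ℂ) (A B : Multiset (Fin n)) :
    (complexConst n c * zetaMonomial A B).re ∈ orderIdeal (Coord n) ℝ (A.card + B.card) := by
  have := (complexSeries_mul_mem (p := 0) (u := complexConst n c)
    ⟨mem_orderIdeal_zero _, mem_orderIdeal_zero _⟩ (zetaMonomial_mem A B)).1
  rwa [zero_add] at this

/-- The real parts of the complex monomials of degree `m`. -/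
def reMonomials (n m : ℕ) : Submodule ℝ (Series n) :=
  Submodule.span ℝ {f | ∃ (c : ℂ) (A B : Multiset (Fin n)), A.card + B.card = m ∧
    f = (complexConst n c * zetaMonomial A B).re}

theorem algebraMap_X_inl (j : Fin n) :
    algebraMap (Series n) (ComplexSeries n) (MvPowerSeries.X (Sum.inl j)) =
      complexConst n (1 / 2) * zeta j + complexConst n (1 / 2) * zetaBar j := by
  have h := C_half_mul_two (n := n)
  have h1 : (1 / 2 : ℂ).re = 1 / 2 := by simp
  have h2 : (1 / 2 : ℂ).im = 0 := by simp
  ext1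
  · simp only [complexConst, zeta, zetaBar, RingHom.coe_mk, MonoidHom.coe_mk, OneHom.coe_mk,
      QuadraticAlgebra.algebraMap_re, QuadraticAlgebra.re_add, QuadraticAlgebra.re_mul, h1, h2,
      map_zero]
    linear_combination -MvPowerSeries.X (Sum.inl j) * h
  · simp only [complexConst, zeta, zetaBar, RingHom.coe_mk, MonoidHom.coe_mk, OneHom.coe_mk,
      QuadraticAlgebra.algebraMap_im, QuadraticAlgebra.im_add, QuadraticAlgebra.im_mul, h1, h2,
      map_zero]
    ring

theorem algebraMap_X_inr (j : Fin n) :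
    algebraMap (Series n) (ComplexSeries n) (MvPowerSeries.X (Sum.inr j)) =
      complexConst n (-Complex.I / 2) * zeta j + complexConst n (Complex.I / 2) * zetaBar j := by
  have h := C_half_mul_two (n := n)
  have h1 : (Complex.I / 2 : ℂ).re = 0 := by simp
  have h2 : (Complex.I / 2 : ℂ).im = 1 / 2 := by simp
  have h3 : (-Complex.I / 2 : ℂ).re = 0 := by simp
  have h4 : (-Complex.I / 2 : ℂ).im = -(1 / 2) := by simp [neg_div]
  ext1
  · simp only [complexConst, zeta, zetaBar, RingHom.coe_mk, MonoidHom.coe_mk, OneHom.coe_mk,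
      QuadraticAlgebra.algebraMap_re, QuadraticAlgebra.re_add, QuadraticAlgebra.re_mul, h1, h2,
      h3, h4, map_zero, map_neg]
    linear_combination -MvPowerSeries.X (Sum.inr j) * h
  · simp only [complexConst, zeta, zetaBar, RingHom.coe_mk, MonoidHom.coe_mk, OneHom.coe_mk,
      QuadraticAlgebra.algebraMap_im, QuadraticAlgebra.im_add, QuadraticAlgebra.im_mul, h1, h2,
      h3, h4, map_zero, map_neg]
    ring

/-- The coordinates are combinations of `ζ_j` and `ζ̄_j`, so all real monomials are combinations of
real parts of complex monomials. -/
theorem X_mul_mem_reMonomials (m : ℕ) (a : Coord n) {f : Series n} (hf : f ∈ reMonomials n m) :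
    MvPowerSeries.X a * f ∈ reMonomials n (m + 1) := by
  induction hf using Submodule.span_induction with
  | zero => simp
  | add x y _ _ hx hy => rw [mul_add]; exact add_mem hx hy
  | smul c x _ hx => rw [mul_smul_comm]; exact Submodule.smul_mem _ _ hx
  | mem x hx =>
    obtain ⟨c, A, B, hAB, rfl⟩ := hx
    have hX : ∀ w : ComplexSeries n, MvPowerSeries.X a * w.re =
        (algebraMap (Series n) (ComplexSeries n) (MvPowerSeries.X a) * w).re := by
      intro w
      simp [QuadraticAlgebra.re_mul]
    have key : ∀ (j : Fin n) (u v : ℂ),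
        ((complexConst n u * zeta j + complexConst n v * zetaBar j) *
          (complexConst n c * zetaMonomial A B)).re ∈ reMonomials n (m + 1) := by
      intro j u v
      have : (complexConst n u * zeta j + complexConst n v * zetaBar j) *
          (complexConst n c * zetaMonomial A B) =
          complexConst n (u * c) * zetaMonomial (j ::ₘ A) B +
            complexConst n (v * c) * zetaMonomial A (j ::ₘ B) := by
        rw [zetaMonomial_cons_left, zetaMonomial_cons_right, map_mul, map_mul]
        ring
      rw [this, QuadraticAlgebra.re_add]
      refine add_mem (Submodule.subset_span ⟨_, _, _, ?_, rfl⟩)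
        (Submodule.subset_span ⟨_, _, _, ?_, rfl⟩)
      · rw [Multiset.card_cons]; omega
      · rw [Multiset.card_cons]; omega
    rw [hX]
    rcases a with j | j
    · rw [algebraMap_X_inl]; exact key _ _ _
    · rw [algebraMap_X_inr]; exact key _ _ _

theorem one_mem_reMonomials : (1 : Series n) ∈ reMonomials n 0 :=
  Submodule.subset_span ⟨1, 0, 0, rfl, by simp [zetaMonomial]; rfl⟩

theorem startsAtDegree_linearMap (A : Matrix (Coord n) (Coord n) ℝ) :
    StartsAtDegree 1 (linearMap A) := fun a => by
  change ∑ b, MvPowerSeries.C (A a b) * MvPowerSeries.X b ∈ orderIdeal (Coord n) ℝ 1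
  exact Ideal.sum_mem _ fun b _ => Ideal.mul_mem_left _ _ (X_mem_orderIdeal b)

theorem linearMap_eq_constMulVec (A : Matrix (Coord n) (Coord n) ℝ) :
    linearMap A = constMulVec A (idMap n) := rfl

/-- The pullback by the linear map of matrix `A`, as an algebra homomorphism. -/
def linearPullback (A : Matrix (Coord n) (Coord n) ℝ) : Series n →ₐ[ℝ] Series n :=
  MvPowerSeries.substAlgHom (startsAtDegree_linearMap A).hasSubst

theorem linearPullback_apply (A : Matrix (Coord n) (Coord n) ℝ) (f : Series n) :
    linearPullback A f = MvPowerSeries.subst (linearMap A) f :=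
  MvPowerSeries.substAlgHom_apply _ f

theorem linearPullback_C (A : Matrix (Coord n) (Coord n) ℝ) (r : ℝ) :
    linearPullback A (MvPowerSeries.C r) = MvPowerSeries.C r := by
  rw [linearPullback_apply, MvPowerSeries.subst_C]

theorem linearPullback_X (A : Matrix (Coord n) (Coord n) ℝ) (a : Coord n) :
    linearPullback A (MvPowerSeries.X a) = linearMap A a :=
  MvPowerSeries.substAlgHom_X _ a

theorem linearMap_rotationMatrix_inl (ω : Fin n → ℝ) (j : Fin n) :
    linearMap (rotationMatrix ω) (Sum.inl j) =
      MvPowerSeries.C (Real.cos (ω j)) * MvPowerSeries.X (Sum.inl j) -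
        MvPowerSeries.C (Real.sin (ω j)) * MvPowerSeries.X (Sum.inr j) := by
  rw [linearMap_eq_constMulVec, constMulVec, rotationMatrix_map, blockRotation_mulVec_inl]
  rfl

theorem linearMap_rotationMatrix_inr (ω : Fin n → ℝ) (j : Fin n) :
    linearMap (rotationMatrix ω) (Sum.inr j) =
      MvPowerSeries.C (Real.sin (ω j)) * MvPowerSeries.X (Sum.inl j) +
        MvPowerSeries.C (Real.cos (ω j)) * MvPowerSeries.X (Sum.inr j) := by
  rw [linearMap_eq_constMulVec, constMulVec, rotationMatrix_map, blockRotation_mulVec_inr]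
  rfl

theorem complexify_complexConst (A : Matrix (Coord n) (Coord n) ℝ) (c : ℂ) :
    complexify (linearPullback A) (complexConst n c) = complexConst n c := by
  ext1
  · exact linearPullback_C A c.re
  · exact linearPullback_C A c.im

theorem exp_I_mul_re (x : ℝ) : (Complex.exp (Complex.I * x)).re = Real.cos x := by
  rw [mul_comm, Complex.exp_ofReal_mul_I_re]

theorem exp_I_mul_im (x : ℝ) : (Complex.exp (Complex.I * x)).im = Real.sin x := by
  rw [mul_comm, Complex.exp_ofReal_mul_I_im]

theorem complexify_zeta (ω : Fin n → ℝ) (j : Fin n) :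
    complexify (linearPullback (rotationMatrix ω)) (zeta j) =
      complexConst n (Complex.exp (Complex.I * (ω j : ℝ))) * zeta j := by
  ext1
  · change linearPullback _ (MvPowerSeries.X (Sum.inl j)) = _
    rw [linearPullback_X, linearMap_rotationMatrix_inl, QuadraticAlgebra.re_mul]
    simp only [complexConst, zeta, RingHom.coe_mk, MonoidHom.coe_mk, OneHom.coe_mk, exp_I_mul_re,
      exp_I_mul_im]
    ring
  · change linearPullback _ (MvPowerSeries.X (Sum.inr j)) = _
    rw [linearPullback_X, linearMap_rotationMatrix_inr, QuadraticAlgebra.im_mul]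
    simp only [complexConst, zeta, RingHom.coe_mk, MonoidHom.coe_mk, OneHom.coe_mk, exp_I_mul_re,
      exp_I_mul_im]
    ring

theorem complexify_zetaBar (ω : Fin n → ℝ) (j : Fin n) :
    complexify (linearPullback (rotationMatrix ω)) (zetaBar j) =
      complexConst n (Complex.exp (Complex.I * ((-ω j : ℝ) : ℂ))) * zetaBar j := by
  ext1
  · change linearPullback _ (MvPowerSeries.X (Sum.inl j)) = _
    rw [linearPullback_X, linearMap_rotationMatrix_inl, QuadraticAlgebra.re_mul]
    simp only [complexConst, zetaBar, RingHom.coe_mk, MonoidHom.coe_mk, OneHom.coe_mk,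
      exp_I_mul_re, exp_I_mul_im, Real.cos_neg, Real.sin_neg, map_neg]
    ring
  · change linearPullback _ (-MvPowerSeries.X (Sum.inr j)) = _
    rw [map_neg, linearPullback_X, linearMap_rotationMatrix_inr, QuadraticAlgebra.im_mul]
    simp only [complexConst, zetaBar, RingHom.coe_mk, MonoidHom.coe_mk, OneHom.coe_mk,
      exp_I_mul_re, exp_I_mul_im, Real.cos_neg, Real.sin_neg, map_neg]
    ring

/-- The rotation multiplies a complex monomial by the phase `e^{i⟨k,ω⟩}`, where `k` is the
difference of its exponents. -/
theorem complexify_zetaMonomial (ω : Fin n → ℝ) (A B : Multiset (Fin n)) :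
    complexify (linearPullback (rotationMatrix ω)) (zetaMonomial A B) =
      complexConst n (Complex.exp (Complex.I *
        (((A.map ω).sum - (B.map ω).sum : ℝ) : ℂ))) * zetaMonomial A B := by
  induction A using Multiset.induction_on with
  | empty =>
    induction B using Multiset.induction_on with
    | empty => simp [zetaMonomial]
    | cons j B ih =>
      rw [zetaMonomial_cons_right, map_mul, ih, complexify_zetaBar, mul_mul_mul_comm, ← map_mul,
        ← Complex.exp_add, ← mul_add, ← Complex.ofReal_add, Multiset.map_cons, Multiset.sum_cons]
      congr 5
      ring
  | cons j A ih =>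
    rw [zetaMonomial_cons_left, map_mul, ih, complexify_zeta, mul_mul_mul_comm, ← map_mul,
      ← Complex.exp_add, ← mul_add, ← Complex.ofReal_add, Multiset.map_cons, Multiset.sum_cons]
    congr 5
    ring

theorem exp_phase_ne_one {ω : Fin n → ℝ} (hω : NonResonant ω) {A B : Multiset (Fin n)}
    (hAB : A ≠ B) :
    Complex.exp (Complex.I * (((A.map ω).sum - (B.map ω).sum : ℝ) : ℂ)) ≠ 1 := by
  classical
  have hs : ∀ A : Multiset (Fin n), (A.map ω).sum = ∑ l, (A.count l : ℝ) * ω l := by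
    intro A
    rw [Finset.sum_multiset_map_count]
    simp only [nsmul_eq_mul]
    refine Finset.sum_subset (Finset.subset_univ _) fun l _ hl => ?_
    rw [Multiset.mem_toFinset] at hl
    rw [Multiset.count_eq_zero_of_notMem hl]
    simp
  have hm : (fun l => (A.count l : ℤ) - (B.count l : ℤ)) ≠ 0 := by
    intro h
    refine hAB (Multiset.ext.2 fun l => ?_)
    have := congrFun h l
    simp only [Pi.zero_apply] at this
    omega
  have he : ∑ l, ((A.count l : ℝ) * ω l - (B.count l : ℝ) * ω l) =
      ∑ l, (((A.count l : ℤ) - (B.count l : ℤ) : ℤ) : ℝ) * ω l := by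
    refine Finset.sum_congr rfl fun l _ => ?_
    push_cast
    ring
  rw [hs, hs, ← Finset.sum_sub_distrib, he]
  exact hω.exp_ne_one hm

/-- The monomial `∏_{j ∈ A} 2 I_j` as a power series in the actions. -/
def actionMonomial (A : Multiset (Fin n)) : ActionSeries n :=
  (A.map fun j => 2 * MvPowerSeries.X j).prod

theorem actionMonomial_mem (A : Multiset (Fin n)) :
    actionMonomial A ∈ orderIdeal (Fin n) ℝ A.card := by
  induction A using Multiset.induction_on with
  | empty => exact mem_orderIdeal_zero _
  | cons j A ih =>
    rw [actionMonomial, Multiset.map_cons, Multiset.prod_cons, Multiset.card_cons, add_comm]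
    exact mul_mem_orderIdeal (Ideal.mul_mem_left _ _ (X_mem_orderIdeal j)) ih

theorem zetaMonomial_self (A : Multiset (Fin n)) :
    zetaMonomial A A = algebraMap (Series n) _ (evalActions n (actionMonomial A)) := by
  induction A using Multiset.induction_on with
  | empty => simp [zetaMonomial, actionMonomial]
  | cons j A ih =>
    have hX : evalActions n (MvPowerSeries.X j) = actionVar j :=
      MvPowerSeries.substAlgHom_X _ j
    have h := C_half_mul_two (n := n)
    have hz : zeta j * zetaBar j =
        algebraMap (Series n) (ComplexSeries n) (evalActions n (2 * MvPowerSeries.X j)) := by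
      rw [map_mul, hX, map_ofNat]
      ext1
      · simp only [QuadraticAlgebra.re_mul, QuadraticAlgebra.algebraMap_re, zeta, zetaBar,
          actionVar]
        linear_combination -(MvPowerSeries.X (Sum.inl j) ^ 2 +
          MvPowerSeries.X (Sum.inr j) ^ 2) * h
      · simp only [QuadraticAlgebra.im_mul, QuadraticAlgebra.algebraMap_im, zeta, zetaBar]
        ring
    rw [zetaMonomial_cons_left, zetaMonomial_cons_right, ih, ← mul_assoc, hz, ← map_mul, ← map_mul,
      actionMonomial, actionMonomial, Multiset.map_cons, Multiset.prod_cons]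

/-- The homological equation `K ∘ Λ - K + k(I) = f` has a solution `K`, `k` up to terms of degree
more than `m`. The order required of `k` makes `k(I)` start at degree `m`. -/
def IsHomologicallySolvable (ω : Fin n → ℝ) (m : ℕ) (f : Series n) : Prop :=
  ∃ K ∈ orderIdeal (Coord n) ℝ m, ∃ k ∈ orderIdeal (Fin n) ℝ ((m + 1) / 2),
    f - (linearPullback (rotationMatrix ω) K - K + evalActions n k) ∈
      orderIdeal (Coord n) ℝ (m + 1)

theorem IsHomologicallySolvable.add {ω : Fin n → ℝ} {m : ℕ} {f g : Series n}
    (hf : IsHomologicallySolvable ω m f) (hg : IsHomologicallySolvable ω m g) :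
    IsHomologicallySolvable ω m (f + g) := by
  obtain ⟨K, hK, k, hk, h⟩ := hf
  obtain ⟨L, hL, l, hl, h'⟩ := hg
  refine ⟨K + L, add_mem hK hL, k + l, add_mem hk hl, ?_⟩
  convert add_mem h h' using 1
  rw [map_add, map_add]
  ring

theorem IsHomologicallySolvable.smul {ω : Fin n → ℝ} {m : ℕ} {f : Series n} (c : ℝ)
    (hf : IsHomologicallySolvable ω m f) : IsHomologicallySolvable ω m (c • f) := by
  obtain ⟨K, hK, k, hk, h⟩ := hf
  refine ⟨c • K, Submodule.smul_of_tower_mem _ c hK, c • k, Submodule.smul_of_tower_mem _ c hk, ?_⟩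
  convert Submodule.smul_of_tower_mem _ c h using 1
  rw [map_smul, map_smul, smul_sub, smul_add, smul_sub]

/-- On a monomial the rotation acts by a phase; it is different from `1`, by non-resonance, unless
the monomial is a product of actions. -/
theorem isHomologicallySolvable_monomial {ω : Fin n → ℝ} (hω : NonResonant ω) (c : ℂ)
    (A B : Multiset (Fin n)) :
    IsHomologicallySolvable ω (A.card + B.card) (complexConst n c * zetaMonomial A B).re := by
  by_cases hAB : A = B
  · subst hAB
    refine ⟨0, zero_mem _, MvPowerSeries.C c.re * actionMonomial A, ?_, ?_⟩
    · exact orderIdeal_anti (by omega) (Ideal.mul_mem_left _ _ (actionMonomial_mem A))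
    · convert (orderIdeal (Coord n) ℝ _).zero_mem using 1
      rw [zetaMonomial_self, map_zero, map_mul, evalActions_C]
      simp [complexConst, QuadraticAlgebra.re_mul]
  · set u := Complex.exp (Complex.I * (((A.map ω).sum - (B.map ω).sum : ℝ) : ℂ)) with hu
    have hu1 : u - 1 ≠ 0 := sub_ne_zero.2 (exp_phase_ne_one hω hAB)
    refine ⟨_, re_complexConst_mul_mem (c / (u - 1)) A B, 0, zero_mem _, ?_⟩
    convert (orderIdeal (Coord n) ℝ _).zero_mem using 1
    have h1 : linearPullback (rotationMatrix ω)
        (complexConst n (c / (u - 1)) * zetaMonomial A B).re =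
        (complexify (linearPullback (rotationMatrix ω))
          (complexConst n (c / (u - 1)) * zetaMonomial A B)).re := rfl
    rw [h1, map_mul, complexify_complexConst, complexify_zetaMonomial, ← hu, map_zero, add_zero,
      ← QuadraticAlgebra.re_sub, ← QuadraticAlgebra.re_sub]
    have h2 : complexConst n c * zetaMonomial A B -
        (complexConst n (c / (u - 1)) * (complexConst n u * zetaMonomial A B) -
          complexConst n (c / (u - 1)) * zetaMonomial A B) = 0 := by
      have h3 : complexConst n c = complexConst n (c / (u - 1)) * (complexConst n u - 1) := by
        rw [← map_one (complexConst n), ← map_sub, ← map_mul, div_mul_cancel₀ _ hu1]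
      rw [h3]
      ring
    rw [h2, QuadraticAlgebra.re_zero]

theorem isHomologicallySolvable_of_mem {ω : Fin n → ℝ} (hω : NonResonant ω) {m : ℕ}
    {f : Series n} (hf : f ∈ orderIdeal (Coord n) ℝ m) : IsHomologicallySolvable ω m f := by
  obtain ⟨g, hg, hfg⟩ := exists_mem_sub_mem_orderIdeal (reMonomials n) one_mem_reMonomials
    (fun m a f hf => X_mul_mem_reMonomials m a hf) hf
  have key : IsHomologicallySolvable ω m g := by
    clear hfg
    induction hg using Submodule.span_induction with
    | zero => exact ⟨0, zero_mem _, 0, zero_mem _, by simp⟩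
    | add x y _ _ hx hy => exact hx.add hy
    | smul c x _ hx => exact hx.smul c
    | mem x hx =>
      obtain ⟨c, A, B, rfl, rfl⟩ := hx
      exact isHomologicallySolvable_monomial hω c A B
  obtain ⟨K, hK, k, hk, h⟩ := key
  exact ⟨K, hK, k, hk, by rw [← sub_add_sub_cancel f g]; exact add_mem hfg h⟩

/-! ### Normalization degree by degree -/

theorem rotationMatrix_mem_symplecticGroup (ω : Fin n → ℝ) (σ : Type*) :
    (rotationMatrix ω).map (MvPowerSeries.C (σ := σ)) ∈
      Matrix.symplecticGroup (Fin n) (MvPowerSeries σ ℝ) := by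
  rw [rotationMatrix_map]
  refine blockRotation_mem_symplecticGroup fun j => ?_
  rw [← map_pow, ← map_pow, ← map_add, Real.cos_sq_add_sin_sq, map_one]

theorem jacobian_constMulVec (A : Matrix (Coord n) (Coord n) ℝ) (W : FormalMap n) :
    jacobian (constMulVec A W) = A.map (MvPowerSeries.C (σ := Coord n)) * jacobian W := by
  ext1 a b
  simp only [jacobian, constMulVec, Matrix.mulVec, dotProduct, Matrix.of_apply, Matrix.mul_apply,
    Matrix.map_apply, map_sum, Derivation.leibniz, MvPowerSeries.pderiv_C, smul_eq_mul,
    mul_zero, add_zero]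

theorem jacobian_add (S T : FormalMap n) : jacobian (S + T) = jacobian S + jacobian T := by
  ext1 a b
  simp [jacobian]

theorem jacobian_idMap : jacobian (idMap n) = 1 := by
  ext1 a b
  simp [jacobian, idMap, MvPowerSeries.pderiv_X, Pi.single_apply, Matrix.one_apply]

theorem isSymplecticMap_idMap : IsSymplecticMap (idMap n) := by
  rw [IsSymplecticMap, jacobian_idMap]
  exact one_mem _

theorem StartsAtDegree.constMulVec {d : ℕ} {W : FormalMap n} (hW : StartsAtDegree d W)
    (A : Matrix (Coord n) (Coord n) ℝ) : StartsAtDegree d (constMulVec A W) := fun a => by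
  change ∑ b, _ * W b ∈ orderIdeal (Coord n) ℝ d
  exact Ideal.sum_mem _ fun b _ => Ideal.mul_mem_left _ _ (hW b)

theorem constMulVec_add (A : Matrix (Coord n) (Coord n) ℝ) (V W : FormalMap n) :
    constMulVec A (V + W) = constMulVec A V + constMulVec A W := Matrix.mulVec_add _ _ _

theorem constMulVec_sub (A : Matrix (Coord n) (Coord n) ℝ) (V W : FormalMap n) :
    constMulVec A (V - W) = constMulVec A V - constMulVec A W := Matrix.mulVec_sub _ _ _

theorem congrMod_iff_startsAtDegree_sub {d : ℕ} {S T : FormalMap n} :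
    CongrMod d S T ↔ StartsAtDegree d (S - T) := Iff.rfl

theorem CongrMod.constMulVec {d : ℕ} {V W : FormalMap n} (h : CongrMod d V W)
    (A : Matrix (Coord n) (Coord n) ℝ) :
    CongrMod d (constMulVec A V) (SymplecticNormalForm.constMulVec A W) := by
  rw [congrMod_iff_startsAtDegree_sub, ← constMulVec_sub]
  exact StartsAtDegree.constMulVec h A

theorem constMulVec_comp (A : Matrix (Coord n) (Coord n) ℝ) (W : FormalMap n) {T : FormalMap n}
    (hT : StartsAtDegree 1 T) : comp (constMulVec A W) T = constMulVec A (comp W T) := by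
  funext a
  simp only [comp, constMulVec, Matrix.mulVec, dotProduct, Matrix.map_apply,
    ← MvPowerSeries.substAlgHom_apply (R := ℝ) hT.hasSubst, map_sum, map_mul]
  simp only [MvPowerSeries.substAlgHom_apply, MvPowerSeries.subst_C]

/-- A power series whose gradient has the prescribed lowest-order part `V`, whose Jacobian matrix
is symmetric to this order: the Poincaré lemma, with Euler's identity in place of an integral. -/
theorem exists_seriesGradient_congrMod {d : ℕ} {V : FormalMap n} (hV : StartsAtDegree (d + 1) V)
    (hsymm : ∀ a b, jacobian V a b - jacobian V b a ∈ orderIdeal (Coord n) ℝ (d + 1)) :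
    ∃ K ∈ orderIdeal (Coord n) ℝ (d + 2), CongrMod (d + 2) V (seriesGradient K) := by
  have hd : (MvPowerSeries.C (1 / (d + 2 : ℝ)) : Series n) * (d + 2) = 1 := by
    have h : (MvPowerSeries.C (d + 2 : ℝ) : Series n) = d + 2 := by
      rw [map_add, map_natCast, map_ofNat]
    rw [← h, ← map_mul, one_div_mul_cancel (by positivity), map_one]
  refine ⟨MvPowerSeries.C (1 / (d + 2 : ℝ)) * ∑ a, MvPowerSeries.X a * V a, ?_, fun b => ?_⟩
  · refine Ideal.mul_mem_left _ _ (Ideal.sum_mem _ fun a _ => ?_)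
    exact orderIdeal_anti (by omega) (mul_mem_orderIdeal (X_mem_orderIdeal a) (hV a))
  · have hE := sum_X_mul_pderiv_sub_mem_orderIdeal (hV b)
    have hS : ∑ a, MvPowerSeries.X a * (jacobian V a b - jacobian V b a) ∈
        orderIdeal (Coord n) ℝ (d + 2) := Ideal.sum_mem _ fun a _ =>
      orderIdeal_anti (by omega) (mul_mem_orderIdeal (X_mem_orderIdeal a) (hsymm a b))
    have hg : seriesGradient (MvPowerSeries.C (1 / (d + 2 : ℝ)) * ∑ a, MvPowerSeries.X a * V a) b =
        MvPowerSeries.C (1 / (d + 2 : ℝ)) *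
          (V b + ∑ a, MvPowerSeries.X a * MvPowerSeries.pderiv ℝ b (V a)) := by
      simp only [seriesGradient, Derivation.leibniz, MvPowerSeries.pderiv_C, map_sum, smul_eq_mul,
        MvPowerSeries.pderiv_X, Pi.single_apply, Finset.sum_add_distrib, mul_ite, mul_one,
        mul_zero, Finset.sum_ite_eq', Finset.mem_univ, if_true, add_zero]
      ring
    have := Ideal.mul_mem_left _ (-MvPowerSeries.C (1 / (d + 2 : ℝ))) (add_mem hS hE)
    convert this using 1
    rw [hg]
    simp only [jacobian, Matrix.of_apply, mul_sub, Finset.sum_sub_distrib]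
    push_cast
    linear_combination -(V b) * hd

/-- The leading part of the difference of two symplectic maps tangent to a rotation is, after
composition with the inverse of this rotation, a Hamiltonian vector field. -/
theorem exists_hamField_of_isSymplecticMap {ω : Fin n → ℝ} {d : ℕ} (hd : 1 ≤ d)
    {R Q : FormalMap n} (hR : IsSymplecticMap R) (hRQ : IsSymplecticMap (R + Q))
    (hQ : StartsAtDegree (d + 1) Q) (hRω : CongrMod 2 R (linearMap (rotationMatrix ω))) :
    ∃ K ∈ orderIdeal (Coord n) ℝ (d + 2),
      CongrMod (d + 2) Q (constMulVec (rotationMatrix ω) (hamField K)) := by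
  set Λ := (rotationMatrix ω).map (MvPowerSeries.C (σ := Coord n)) with hΛ
  set 𝒥 := Matrix.J (Fin n) (Series n) with h𝒥
  -- With `V = -Λᵀ J Q` the claim is that `V` is a gradient to leading order, as `Λ J V = Q`.
  set m : Matrix (Coord n) (Coord n) ℝ := -((rotationMatrix ω).transpose * Matrix.J (Fin n) ℝ)
    with hm
  have hmC : m.map (MvPowerSeries.C (σ := Coord n)) = -(Λ.transpose * 𝒥) := by
    rw [hm, hΛ, h𝒥, ← Matrix.map_J (l := Fin n) (MvPowerSeries.C (σ := Coord n) (R := ℝ)),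
      ← Matrix.transpose_map, ← Matrix.map_mul, ← Matrix.map_neg _ (map_neg _)]
  have hΛJ : Λ * 𝒥 * Λ.transpose = 𝒥 :=
    SymplecticGroup.mem_iff.1 (rotationMatrix_mem_symplecticGroup ω (Coord n))
  have hV : StartsAtDegree (d + 1) (constMulVec m Q) := hQ.constMulVec m
  set A := jacobian Q with hA
  have hAmem : ∀ a b, A a b ∈ orderIdeal (Coord n) ℝ d := fun a b =>
    pderiv_mem_orderIdeal (hQ a) b
  set E := jacobian R - Λ with hE
  have hEmem : ∀ a b, E a b ∈ orderIdeal (Coord n) ℝ 1 := by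
    intro a b
    have h1 : Λ = jacobian (linearMap (rotationMatrix ω)) := by
      rw [linearMap_eq_constMulVec, jacobian_constMulVec, jacobian_idMap, mul_one]
    have := pderiv_mem_orderIdeal (hRω a) b
    rw [map_sub] at this
    rw [hE, h1]
    exact this
  have hmul : ∀ {p q : ℕ} {M N : Matrix (Coord n) (Coord n) (Series n)},
      (∀ a b, M a b ∈ orderIdeal (Coord n) ℝ p) → (∀ a b, N a b ∈ orderIdeal (Coord n) ℝ q) →
      ∀ a b, (M * N) a b ∈ orderIdeal (Coord n) ℝ (p + q) := fun hM hN a b => by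
    rw [Matrix.mul_apply]
    exact Ideal.sum_mem _ fun c _ => mul_mem_orderIdeal (hM a c) (hN c b)
  have hmulJ : ∀ {p : ℕ} {M : Matrix (Coord n) (Coord n) (Series n)},
      (∀ a b, M a b ∈ orderIdeal (Coord n) ℝ p) →
      ∀ a b, (M.transpose * 𝒥) a b ∈ orderIdeal (Coord n) ℝ p := fun hM a b => by
    rw [Matrix.mul_apply]
    exact Ideal.sum_mem _ fun c _ => Ideal.mul_mem_right _ _ (hM c a)
  have h1 : (jacobian R).transpose * 𝒥 * jacobian R = 𝒥 := SymplecticGroup.mem_iff'.1 hR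
  have h2 : (jacobian R + A).transpose * 𝒥 * (jacobian R + A) = 𝒥 := by
    rw [← jacobian_add]; exact SymplecticGroup.mem_iff'.1 hRQ
  have hREΛ : jacobian R = Λ + E := by rw [hE]; abel
  -- The linearized symplecticity condition, with terms of degree at least `d + 1` on the right.
  have h3 : Λ.transpose * 𝒥 * A + A.transpose * 𝒥 * Λ =
      -(E.transpose * 𝒥 * A + A.transpose * 𝒥 * E + A.transpose * 𝒥 * A) := by
    have h4 : (jacobian R + A).transpose * 𝒥 * (jacobian R + A) =
        (jacobian R).transpose * 𝒥 * jacobian R + ((Λ + E).transpose * 𝒥 * A +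
          A.transpose * 𝒥 * (Λ + E) + A.transpose * 𝒥 * A) := by
      rw [← hREΛ, Matrix.transpose_add]
      noncomm_ring
    rw [h1, h2, Matrix.transpose_add] at h4
    have h5 := (left_eq_add.1 h4)
    rw [eq_neg_iff_add_eq_zero, ← h5]
    noncomm_ring
  have hsymm : ∀ a b, jacobian (constMulVec m Q) a b - jacobian (constMulVec m Q) b a ∈
      orderIdeal (Coord n) ℝ (d + 1) := by
    intro a b
    have h6 : jacobian (constMulVec m Q) - (jacobian (constMulVec m Q)).transpose =
        E.transpose * 𝒥 * A + A.transpose * 𝒥 * E + A.transpose * 𝒥 * A := by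
      rw [jacobian_constMulVec, hmC, ← hA, ← neg_inj, ← h3, Matrix.transpose_mul,
        Matrix.transpose_neg, Matrix.transpose_mul, Matrix.transpose_transpose, h𝒥,
        Matrix.J_transpose]
      noncomm_ring
    have h7 : jacobian (constMulVec m Q) a b - jacobian (constMulVec m Q) b a =
        (E.transpose * 𝒥 * A) a b + (A.transpose * 𝒥 * E) a b + (A.transpose * 𝒥 * A) a b :=
      congrFun (congrFun h6 a) b
    rw [h7]
    exact add_mem (add_mem (orderIdeal_anti (by omega) (hmul (hmulJ hEmem) hAmem a b))
      (hmul (hmulJ hAmem) hEmem a b)) (orderIdeal_anti (by omega) (hmul (hmulJ hAmem) hAmem a b))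
  obtain ⟨K, hK, hVK⟩ := exists_seriesGradient_congrMod hV hsymm
  refine ⟨K, hK, ?_⟩
  have hback : ∀ W : FormalMap n,
      constMulVec (rotationMatrix ω * Matrix.J (Fin n) ℝ) W = (Λ * 𝒥).mulVec W := by
    intro W
    rw [constMulVec, Matrix.map_mul, Matrix.map_J]
  have hfin := hVK.constMulVec (rotationMatrix ω * Matrix.J (Fin n) ℝ)
  rw [hback, hback] at hfin
  convert hfin using 1
  · rw [constMulVec, hmC, Matrix.mulVec_mulVec, Matrix.mul_neg, ← Matrix.mul_assoc, hΛJ,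
      Matrix.J_squared, neg_neg, Matrix.one_mulVec]
  · rw [hamField, constMulVec, Matrix.mulVec_mulVec]

/-- The transformation rule of Hamiltonian vector fields under a symplectic linear map. -/
theorem comp_hamField_linearMap (ω : Fin n → ℝ) (K : Series n) :
    comp (hamField K) (linearMap (rotationMatrix ω)) =
      constMulVec (rotationMatrix ω) (hamField (linearPullback (rotationMatrix ω) K)) := by
  have h1 := startsAtDegree_linearMap (rotationMatrix ω)
  set Λ := (rotationMatrix ω).map (MvPowerSeries.C (σ := Coord n)) with hΛ
  have hJ : Λ = jacobian (linearMap (rotationMatrix ω)) := by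
    rw [linearMap_eq_constMulVec, jacobian_constMulVec, jacobian_idMap, mul_one]
  have hΛJ : Λ * Matrix.J (Fin n) (Series n) * Λ.transpose = Matrix.J (Fin n) (Series n) :=
    SymplecticGroup.mem_iff.1 (rotationMatrix_mem_symplecticGroup ω (Coord n))
  have hgrad : seriesGradient (linearPullback (rotationMatrix ω) K) =
      Λ.transpose.mulVec (comp (seriesGradient K) (linearMap (rotationMatrix ω))) := by
    funext b
    rw [seriesGradient, linearPullback_apply, pderiv_subst h1]
    simp only [Matrix.mulVec, dotProduct, Matrix.transpose_apply, hJ, jacobian, Matrix.of_apply,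
      comp, seriesGradient]
    exact Finset.sum_congr rfl fun _ _ => mul_comm _ _
  have hleft : ∀ W : FormalMap n, (Matrix.J (Fin n) (Series n)).mulVec W =
      constMulVec (Matrix.J (Fin n) ℝ) W := by
    intro W
    rw [constMulVec, Matrix.map_J]
  rw [hamField, hleft, constMulVec_comp _ _ h1, ← hleft, hamField, hgrad, constMulVec,
    Matrix.mulVec_mulVec, Matrix.mulVec_mulVec, hΛJ]

theorem actionMap_congrMod_linearMap {ω : Fin n → ℝ} {c s : Fin n → ActionSeries n}
    (hc : ∀ j, c j - MvPowerSeries.C (Real.cos (ω j)) ∈ orderIdeal (Fin n) ℝ 1)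
    (hs : ∀ j, s j - MvPowerSeries.C (Real.sin (ω j)) ∈ orderIdeal (Fin n) ℝ 1) :
    CongrMod 2 (actionMap (blockRotation c s)) (linearMap (rotationMatrix ω)) := by
  have hI : ∀ {f : ActionSeries n} (a : Coord n), f ∈ orderIdeal (Fin n) ℝ 1 →
      evalActions n f * MvPowerSeries.X a ∈ orderIdeal (Coord n) ℝ 2 := fun a hf =>
    Ideal.mul_mem_right _ _ (evalActions_mem hf)
  rintro (j | j)
  · rw [actionMap_blockRotation, blockRotation_mulVec_inl, linearMap_rotationMatrix_inl]
    convert sub_mem (hI (Sum.inl j) (hc j)) (hI (Sum.inr j) (hs j)) using 1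
    simp only [map_sub, evalActions_C]
    ring
  · rw [actionMap_blockRotation, blockRotation_mulVec_inr, linearMap_rotationMatrix_inr]
    convert add_mem (hI (Sum.inl j) (hs j)) (hI (Sum.inr j) (hc j)) using 1
    simp only [map_sub, evalActions_C]
    ring

/-- One step of the normalization: a conjugation by a symplectic map `S`, and a correction of the
angles, raise the order of the remainder by one. The Hamiltonian of `S` and the correction solve the
homological equation for the Hamiltonian of the leading part of the remainder. -/
theorem exists_conj_normalForm_succ {ω : Fin n → ℝ} (hω : NonResonant ω) (d : ℕ)
    {c s : Fin n → ActionSeries n} (h : IsAngleData c s)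
    (hc : ∀ j, c j - MvPowerSeries.C (Real.cos (ω j)) ∈ orderIdeal (Fin n) ℝ 1)
    (hs : ∀ j, s j - MvPowerSeries.C (Real.sin (ω j)) ∈ orderIdeal (Fin n) ℝ 1)
    {P : FormalMap n} (hP : StartsAtDegree (d + 2) P)
    (hG : IsSymplecticMap (actionMap (blockRotation c s) + P)) :
    ∃ (S : FormalMap n) (c' s' : Fin n → ActionSeries n) (P' : FormalMap n),
      StartsAtDegree 1 S ∧ CongrMod 2 S (idMap n) ∧ IsSymplecticMap S ∧ IsAngleData c' s' ∧
      (∀ j, c' j - MvPowerSeries.C (Real.cos (ω j)) ∈ orderIdeal (Fin n) ℝ 1) ∧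
      (∀ j, s' j - MvPowerSeries.C (Real.sin (ω j)) ∈ orderIdeal (Fin n) ℝ 1) ∧
      StartsAtDegree (d + 3) P' ∧
      comp (actionMap (blockRotation c s) + P) S =
        comp S (actionMap (blockRotation c' s') + P') := by
  set R := actionMap (blockRotation c s) with hRdef
  set Λ := rotationMatrix ω with hΛ
  have hR1 : StartsAtDegree 1 R := startsAtDegree_actionMap _
  have hΛ1 : StartsAtDegree 1 (linearMap Λ) := startsAtDegree_linearMap _
  have hRΛ : CongrMod 2 R (linearMap Λ) := actionMap_congrMod_linearMap hc hs
  obtain ⟨K', hK', hPK'⟩ := exists_hamField_of_isSymplecticMap (d := d + 1) (by omega)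
    h.isSymplecticMap hG hP hRΛ
  obtain ⟨K, hK, k, hk, hKk⟩ := isHomologicallySolvable_of_mem hω hK'
  obtain ⟨p, hp⟩ : ∃ p, (d + 1 + 2 + 1) / 2 = p + 2 := ⟨(d + 1 + 2 + 1) / 2 - 2, by omega⟩
  rw [hp] at hk
  obtain ⟨c', s', h', hc', hs', hR'⟩ := exists_isAngleData_congrMod h hc hs
    (show d + 3 ≤ 2 * p + 4 by omega) hk
  set R' := actionMap (blockRotation c' s') with hRdef'
  have hR1' : StartsAtDegree 1 R' := startsAtDegree_actionMap _
  have hRΛ' : CongrMod 2 R' (linearMap Λ) := actionMap_congrMod_linearMap hc' hs'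
  obtain ⟨S, S', hS1, hS1', hSS', hSS, hSsymp, hSK⟩ := generates_of_mem (m := d) hK
  have hXK : StartsAtDegree (d + 1 + 1) (hamField K) := startsAtDegree_hamField hK
  have hSid : CongrMod (d + 2) S (idMap n) := (hSK.mono (by omega)).trans fun a => by
    rw [Pi.add_apply, add_sub_cancel_left]
    exact hXK a
  have hG1 : StartsAtDegree 1 (R + P) := hR1.add (hP.mono (by omega))
  -- `G ∘ S = G + Λ J∇K + …`
  have hGS : CongrMod (d + 3) (comp (R + P) S) (R + P + constMulVec Λ (hamField K)) := by
    have hV : StartsAtDegree (1 + 1) (R + P - linearMap Λ) := by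
      rw [add_sub_right_comm]
      exact StartsAtDegree.add hRΛ (hP.mono (by omega))
    have e1 := CongrMod.comp_left_add hV hS1 startsAtDegree_idMap hSid
    rw [comp_idMap] at e1
    have e2 := hSK.constMulVec Λ
    rw [constMulVec_add, ← linearMap_eq_constMulVec] at e2
    have e3 : comp (linearMap Λ) S = constMulVec Λ S := by
      rw [linearMap_eq_constMulVec, constMulVec_comp _ _ hS1, idMap_comp hS1]
    have e4 := e2.add (e1.mono (by omega : d + 3 ≤ 1 + (d + 2)))
    rw [← e3, ← add_comp _ _ hS1, add_sub_cancel] at e4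
    convert e4 using 1
    abel
  -- `S ∘ R' = R' + Λ J∇(K ∘ Λ) + …`
  have hSR : CongrMod (d + 3) (comp S R')
      (R' + constMulVec Λ (hamField (linearPullback Λ K))) := by
    have e1 := hSK.comp_right hR1'
    rw [add_comp _ _ hR1', idMap_comp hR1'] at e1
    refine e1.trans ((CongrMod.refl _ _).add ?_)
    rw [← comp_hamField_linearMap]
    exact (CongrMod.comp_left_add hXK hR1' hΛ1 hRΛ').mono (by omega)
  -- The homological equation makes the two expansions agree.
  have hmain : CongrMod (d + 3) (comp (R + P) S) (comp S R') := by
    refine hGS.trans (CongrMod.trans ?_ hSR.symm)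
    have e1 : CongrMod (d + 3) (R + P + constMulVec Λ (hamField K))
        (R + constMulVec Λ (hamField K') + constMulVec Λ (hamField K)) :=
      ((CongrMod.refl _ _).add hPK').add (CongrMod.refl _ _)
    have e2 : CongrMod (d + 3) (R + constMulVec Λ (hamField (evalActions n k)) +
        constMulVec Λ (hamField (linearPullback Λ K)))
        (R' + constMulVec Λ (hamField (linearPullback Λ K))) :=
      hR'.symm.add (CongrMod.refl _ _)
    refine e1.trans (CongrMod.trans ?_ e2)
    have e3 : StartsAtDegree (d + 3) (constMulVec Λ (hamField
        (K' - (linearPullback Λ K - K + evalActions n k)))) :=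
      (startsAtDegree_hamField hKk).constMulVec Λ
    rw [congrMod_iff_startsAtDegree_sub]
    convert e3 using 1
    simp only [hamField_sub, hamField_add, constMulVec_sub, constMulVec_add]
    abel
  have hGS1 : StartsAtDegree 1 (comp (R + P) S) := hG1.comp hS1
  -- The remainder is defined by `R' + P' = S⁻¹ ∘ G ∘ S`.
  refine ⟨S, c', s', comp S' (comp (R + P) S) - R', hS1, hSid.mono (by omega), hSsymp, h', hc',
    hs', ?_, ?_⟩
  · have e := CongrMod.comp_left S' hGS1 (hS1.comp hR1') hmain
    rwa [← comp_assoc S' hS1 hR1', hSS, idMap_comp hR1', congrMod_iff_startsAtDegree_sub] at e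
  · rw [add_sub_cancel, ← comp_assoc S hS1' hGS1, hSS', idMap_comp hGS1]

/-- Normalization up to a remainder of degree at least `d + 2`, by induction on `d`. The conjugated
map is again symplectic, which allows for the next step. -/
theorem exists_conj_normalForm {ω : Fin n → ℝ} (hω : NonResonant ω) {F F₂ : FormalMap n}
    (hF₂ : StartsAtDegree 2 F₂) (hF : F = linearMap (rotationMatrix ω) + F₂)
    (hsymp : IsSymplecticMap F) (d : ℕ) :
    ∃ (Φ : FormalMap n) (c s : Fin n → ActionSeries n) (P : FormalMap n),
      StartsAtDegree 1 Φ ∧ CongrMod 2 Φ (idMap n) ∧ IsSymplecticMap Φ ∧ IsAngleData c s ∧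
      (∀ j, c j - MvPowerSeries.C (Real.cos (ω j)) ∈ orderIdeal (Fin n) ℝ 1) ∧
      (∀ j, s j - MvPowerSeries.C (Real.sin (ω j)) ∈ orderIdeal (Fin n) ℝ 1) ∧
      StartsAtDegree (d + 2) P ∧
      comp F Φ = comp Φ (actionMap (blockRotation c s) + P) := by
  have hF1 : StartsAtDegree 1 F := by
    rw [hF]
    exact (startsAtDegree_linearMap _).add (hF₂.mono (by omega))
  induction d with
  | zero =>
    refine ⟨idMap n, fun j => MvPowerSeries.C (Real.cos (ω j)),
      fun j => MvPowerSeries.C (Real.sin (ω j)), F₂, startsAtDegree_idMap, CongrMod.refl _ _,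
      isSymplecticMap_idMap, ⟨fun j => ?_, fun _ _ => 0, fun _ _ => rfl, fun j k => ?_,
        fun j k => ?_⟩, fun j => by simp, fun j => by simp, hF₂, ?_⟩
    · rw [← map_pow, ← map_pow, ← map_add, Real.cos_sq_add_sin_sq, map_one]
    · rw [MvPowerSeries.pderiv_C, mul_zero, neg_zero]
    · rw [MvPowerSeries.pderiv_C, mul_zero]
    · have hL : actionMap (blockRotation (fun j => MvPowerSeries.C (Real.cos (ω j)))
          fun j => MvPowerSeries.C (Real.sin (ω j))) = linearMap (rotationMatrix ω) := by
        rw [actionMap_blockRotation, linearMap_eq_constMulVec, constMulVec, rotationMatrix_map]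
        simp only [evalActions_C]
        rfl
      rw [hL, ← hF, comp_idMap, idMap_comp hF1]
  | succ d ih =>
    obtain ⟨Φ, c, s, P, hΦ1, hΦid, hΦ, h, hc, hs, hP, hconj⟩ := ih
    have hG1 : StartsAtDegree 1 (actionMap (blockRotation c s) + P) :=
      (startsAtDegree_actionMap _).add (hP.mono (by omega))
    obtain ⟨S, c', s', P', hS1, hSid, hS, h', hc', hs', hP', hconj'⟩ :=
      exists_conj_normalForm_succ hω d h hc hs hP (hsymp.of_conj hΦ hΦ1 hG1 hconj)
    have hG1' : StartsAtDegree 1 (actionMap (blockRotation c' s') + P') :=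
      (startsAtDegree_actionMap _).add (hP'.mono (by omega))
    refine ⟨comp Φ S, c', s', P', hΦ1.comp hS1, ?_, hΦ.comp hS hS1, h', hc', hs', hP', ?_⟩
    · have := hΦid.comp_right hS1
      rw [idMap_comp hS1] at this
      exact this.trans hSid
    · rw [← comp_assoc F hΦ1 hS1, hconj, comp_assoc Φ hG1 hS1, hconj', comp_assoc Φ hS1 hG1']

end SymplecticNormalForm
end

theorem mainTheorem1 (n : ℕ) (ω : Fin n → ℝ) (hω : NonResonant ω)
    (F F₂ : FormalMap n) (hF₂ : StartsAtDegree 2 F₂)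
    (hF : F = linearMap (rotationMatrix ω) + F₂) (hsymp : IsSymplecticMap F)
    (r : ℕ) (hr : 1 ≤ r) :
    -- the transformation `w = Φ(z)`, the correction `Ω̃`, the matrix `Ω`, and the remainder
    ∃ (Φ : FormalMap n) (Ωt Ω : Matrix (Coord n) (Coord n) (ActionSeries n))
      (P : FormalMap n),
      IsNearIdentity Φ ∧ IsSymplecticMap Φ ∧
      -- `Φ` conjugates `w' = F(w)` to `z' = Ω(I) z + P(z)`
      comp F Φ = comp Φ (actionMap Ω + P) ∧
      -- `Ω = Λ_ω + Ω̃(I)`, with `Ω̃` at least linear in the actions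
      Ω = (rotationMatrix ω).map MvPowerSeries.C + Ωt ∧
      (∀ a b, 1 ≤ (Ωt a b).order) ∧
      Ω ∈ Matrix.symplecticGroup (Fin n) (ActionSeries n) ∧
      StartsAtDegree (r + 2) P ∧
      -- the truncated map `z' = Ω(I) z` is integrable, the actions being its integrals
      IsIntegrableWith (actionMap Ω) actionVar := by
  obtain ⟨Φ, c, s, P, -, hΦid, hΦ, h, hc, hs, hP, hconj⟩ :=
    exists_conj_normalForm hω hF₂ hF hsymp r
  refine ⟨Φ, blockRotation c s - (rotationMatrix ω).map MvPowerSeries.C, blockRotation c s, P,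
    ⟨Φ - idMap n, hΦid, fun a => ?_⟩, hΦ, hconj, by rw [add_sub_cancel], fun a b => ?_,
    blockRotation_mem_symplecticGroup h.sq_add_sq, hP, h.isIntegrableWith⟩
  · rw [Pi.sub_apply, idMap, add_sub_cancel]
  · have key : ∀ i j, (if i = j then c i - MvPowerSeries.C (Real.cos (ω i)) else 0) ∈
        orderIdeal (Fin n) ℝ 1 := fun i j => by
      split_ifs
      exacts [hc i, zero_mem _]
    have key' : ∀ i j, (if i = j then s i - MvPowerSeries.C (Real.sin (ω i)) else 0) ∈
        orderIdeal (Fin n) ℝ 1 := fun i j => by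
      split_ifs
      exacts [hs i, zero_mem _]
    suffices hmem : (blockRotation c s - (rotationMatrix ω).map MvPowerSeries.C :
        Matrix (Coord n) (Coord n) (ActionSeries n)) a b ∈
        orderIdeal (Fin n) ℝ 1 by simpa [mem_orderIdeal] using hmem
    rw [rotationMatrix_map]
    rcases a with i | i <;> rcases b with j | j
    · convert key i j using 1
      simp only [blockRotation, Matrix.sub_apply, Matrix.fromBlocks_apply₁₁,
        Matrix.diagonal_apply]
      split_ifs <;> ring
    · convert neg_mem (key' i j) using 1
      simp only [blockRotation, Matrix.sub_apply, Matrix.fromBlocks_apply₁₂, Matrix.neg_apply,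
        Matrix.diagonal_apply]
      split_ifs <;> ring
    · convert key' i j using 1
      simp only [blockRotation, Matrix.sub_apply, Matrix.fromBlocks_apply₂₁,
        Matrix.diagonal_apply]
      split_ifs <;> ring
    · convert key i j using 1
      simp only [blockRotation, Matrix.sub_apply, Matrix.fromBlocks_apply₂₂,
        Matrix.diagonal_apply]
      split_ifs <;> ring
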